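/- Let $q\in\mathbb C\setminus\{0\}$ with $|q|\neq1$, and fix a square root $q^{1/2}$ of $q$. Put $[\tfrac12]_q=\frac{q^{1/2}-q^{-1/2}}{q-q^{-1}}$. Let $U=\mathfrak{osp}_q(1|2)$ be the unital associative $\mathbb C$-algebra with generators $A_+,A_-,K,K^{-1},P$ and relations $$KA_{\pm}K^{-1}=q^{\pm1/2}A_{\pm},\quad A_+A_-+A_-A_+=\frac{K^2-K^{-2}}{q^{1/2}-q^{-1/2}},\quad PA_\pm+A_\pm P=0,\quad PK^{\pm1}=K^{\pm1}P,\quad KK^{-1}=K^{-1}K=1,\quad P^2=1.$$ All tensor products over $\mathbb C$ carry the ungraded product $(a\otimes b)(c\otimes d)=ac\otimes bd$. Let $\Delta:U\to U\otimes U$ be the algebra morphism with $\Delta(A_\pm)=A_\pm\otimes KP+K^{-1}\otimes A_\pm$, $\Delta(K^{\pm1})=K^{\pm1}\otimes K^{\pm1}$, $\Delta(P)=P\otimes P$, and let $$\Gamma=\Big(-A_+A_-+\frac{q^{-1/2}K^2-q^{1/2}K^{-2}}{q-q^{-1}}\Big)P .$$ Let $\mathcal I\subset U$ be the subalgebra generated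 by $A_-K,\ A_+K,\ K^2P,\ \Gamma$; then $\Delta(\mathcal I)\subset U\otimes\mathcal I$. Let $\tau:\mathcal I\to U\otimes\mathcal I$ be the (unique) algebra morphism with $$\begin{aligned} \tau(A_-K)&=K^2P\otimes A_-K,\qquad \tau(\Gamma)=1\otimes\Gamma,\qquad \tau(K^2P)=1\otimes K^2P-(q-q^{-1})A_+K\otimes A_-K,\\ \tau(A_+K)&=K^{-2}P\otimes A_+K+q^{-1/2}(q-q^{-1})A_+^2P\otimes A_-K\\&\quad+q^{-1/2}(q^{1/2}-q^{-1/2})A_+K^{-1}P\otimes K^2P+q^{-1/2}(q-q^{-1})A_+K^{-1}P\otimes\Gamma . \end{aligned}$$ For $A\subseteq\{1,\dots,n\}$ define $\Gamma_A\in U^{\otimes n}$ as follows. Set $\Gamma_\emptyset=-[\tfrac12]_q$. If $A\ne\emptyset$, start from $\Gamma$ and for $k=\min A+1,\dots,\max A$, in increasing order, apply: $1\otimes\dots\otimes1\otimes\Delta$ if $k-1,k\in A$; first $1\otimes\dots\otimes1\otimes\Delta$ and then $1\otimes\dots\otimes1\otimes\tau$ if $k-1\in A$, $k\notin A$; $1\otimes\dots\otimes1\otimes\Delta\otimes1$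 if $k-1,k\notin A$; the identity if $k-1\notin A$, $k\in A$ (in each case $\Delta$ and $\tau$ act on the last tensor factor, except that in the third case $\Delta$ acts on the last but one). The resulting element of $U^{\otimes(\max A-\min A+1)}$ is tensored with $\min A-1$ factors $1$ on the left and $n-\max A$ factors $1$ on the right; this is $\Gamma_A$. Write $[k]=\{1,\dots,k\}$ and $[1;k]=[k]$. For $2\le m\le n-1$ put $$\begin{aligned} C_m={}&(q^{-1/2}-q^{3/2})\,\Gamma_{\{m,m+1\}}\Gamma_{[1;m-1]\cup\{m+1\}}\Gamma_{[m]}+q\,\Gamma_{\{m,m+1\}}^2+q^{-1}\,\Gamma_{[1;m-1]\cup\{m+1\}}^2+q\,\Gamma_{[m]}^2\\ &-(q^{-1/2}-q^{3/2})\big(\Gamma_{\{m\}}\Gamma_{\{m+1\}}+\Gamma_{[m-1]}\Gamma_{[m+1]}\big)\Gamma_{\{m,m+1\}}\\ &-(q^{-1/2}-q^{3/2})\big(\Gamma_{\{m\}}\Gamma_{[m-1]}+\Gamma_{\{m+1\}}\Gamma_{[m+1]}\big)\Gamma_{[m]}\\ &-(q^{1/2}-q^{-3/2})\big(\Gamma_{\{m+1\}}\Gamma_{[m-1]}+\Gamma_{\{m\}}\Gamma_{[m+1]}\big)\Gamma_{[1;m-1]\cup\{m+1\}}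 . \end{aligned}$$ **Lemma.** For $2\le m\le n-1$, $C_m$ is a Casimir element of the unital subalgebra of $U^{\otimes n}$ generated by $\Gamma_{[m]}$, $\Gamma_{\{m,m+1\}}$ and $\Gamma_{[1;m-1]\cup\{m+1\}}$: it belongs to this subalgebra and commutes with all of its elements. Moreover $$C_m=\Gamma_{[m-1]}^2+\Gamma_{\{m\}}^2+\Gamma_{\{m+1\}}^2+\Gamma_{[m+1]}^2-(q-q^{-1})^2\,\Gamma_{\{m\}}\Gamma_{\{m+1\}}\Gamma_{[m-1]}\Gamma_{[m+1]}-\frac{q}{(1+q)^2}.$$ -/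

import Mathlib

open scoped TensorProduct

set_option linter.unusedSimpArgs false

noncomputable section

namespace QBI

/-- Names of the generators of the quantum superalgebra. -/
inductive Gen
  | Ap | Am | K | Kinv | P

open FreeAlgebra in
/-- Defining relations, where `r` is a square root `q ^ (1/2)` of the deformation parameter `q`. -/
inductive Rel (r : ℂˣ) : FreeAlgebra ℂ Gen → FreeAlgebra ℂ Gen → Prop
  | K_Ap : Rel r (ι ℂ Gen.K * ι ℂ Gen.Ap * ι ℂ Gen.Kinv) ((r : ℂ) • ι ℂ Gen.Ap)
  | K_Am : Rel r (ι ℂ Gen.K * ι ℂ Gen.Am * ι ℂ Gen.Kinv) ((r : ℂ)⁻¹ • ι ℂ Gen.Am)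
  | Ap_Am : Rel r (ι ℂ Gen.Ap * ι ℂ Gen.Am + ι ℂ Gen.Am * ι ℂ Gen.Ap)
      (((r : ℂ) - (r : ℂ)⁻¹)⁻¹ • (ι ℂ Gen.K ^ 2 - ι ℂ Gen.Kinv ^ 2))
  | P_Ap : Rel r (ι ℂ Gen.P * ι ℂ Gen.Ap + ι ℂ Gen.Ap * ι ℂ Gen.P) 0
  | P_Am : Rel r (ι ℂ Gen.P * ι ℂ Gen.Am + ι ℂ Gen.Am * ι ℂ Gen.P) 0
  | P_K : Rel r (ι ℂ Gen.P * ι ℂ Gen.K) (ι ℂ Gen.K * ι ℂ Gen.P)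
  | P_Kinv : Rel r (ι ℂ Gen.P * ι ℂ Gen.Kinv) (ι ℂ Gen.Kinv * ι ℂ Gen.P)
  | K_Kinv : Rel r (ι ℂ Gen.K * ι ℂ Gen.Kinv) 1
  | Kinv_K : Rel r (ι ℂ Gen.Kinv * ι ℂ Gen.K) 1
  | P_sq : Rel r (ι ℂ Gen.P ^ 2) 1

/-- The quantum superalgebra `osp_q(1|2)` (extended by its grade involution `P`), with
`q = r ^ 2`. -/
def Osp (r : ℂˣ) : Type := RingQuot (Rel r)

instance (r : ℂˣ) : Ring (Osp r) := inferInstanceAs (Ring (RingQuot (Rel r)))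
instance (r : ℂˣ) : Algebra ℂ (Osp r) := inferInstanceAs (Algebra ℂ (RingQuot (Rel r)))

/-- The class of a generator in `osp_q(1|2)`. -/
def gen (r : ℂˣ) (g : Gen) : Osp r := RingQuot.mkAlgHom ℂ (Rel r) (FreeAlgebra.ι ℂ g)

def Ap (r : ℂˣ) : Osp r := gen r Gen.Ap
def Am (r : ℂˣ) : Osp r := gen r Gen.Am
def K (r : ℂˣ) : Osp r := gen r Gen.K
def Kinv (r : ℂˣ) : Osp r := gen r Gen.Kinv
def P (r : ℂˣ) : Osp r := gen r Gen.P

theorem K_Kinv (r : ℂˣ) : K r * Kinv r = 1 := by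
  have := RingQuot.mkAlgHom_rel ℂ (Rel.K_Kinv (r := r))
  simp only [map_mul, map_one, pow_two] at this
  exact this
theorem Kinv_K (r : ℂˣ) : Kinv r * K r = 1 := by
  have := RingQuot.mkAlgHom_rel ℂ (Rel.Kinv_K (r := r))
  simp only [map_mul, map_one, pow_two] at this
  exact this
theorem P_P (r : ℂˣ) : P r * P r = 1 := by
  have := RingQuot.mkAlgHom_rel ℂ (Rel.P_sq (r := r))
  simp only [map_mul, map_one, pow_two] at this
  exact this
theorem P_K (r : ℂˣ) : P r * K r = K r * P r := by
  have := RingQuot.mkAlgHom_rel ℂ (Rel.P_K (r := r))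
  simp only [map_mul, map_one, pow_two] at this
  exact this
theorem P_Kinv (r : ℂˣ) : P r * Kinv r = Kinv r * P r := by
  have := RingQuot.mkAlgHom_rel ℂ (Rel.P_Kinv (r := r))
  simp only [map_mul, map_one, pow_two] at this
  exact this
theorem P_Ap (r : ℂˣ) : P r * Ap r = -(Ap r * P r) := by
  have := RingQuot.mkAlgHom_rel ℂ (Rel.P_Ap (r := r))
  simp only [map_add, map_mul, map_zero] at this
  exact eq_neg_of_add_eq_zero_left this
theorem P_Am (r : ℂˣ) : P r * Am r = -(Am r * P r) := by
  have := RingQuot.mkAlgHom_rel ℂ (Rel.P_Am (r := r))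
  simp only [map_add, map_mul, map_zero] at this
  exact eq_neg_of_add_eq_zero_left this
theorem K_Ap (r : ℂˣ) : K r * Ap r = (r : ℂ) • (Ap r * K r) := by
  have := RingQuot.mkAlgHom_rel ℂ (Rel.K_Ap (r := r))
  simp only [map_mul, map_smul] at this
  change K r * Ap r * Kinv r = (r : ℂ) • Ap r at this
  rw [← smul_mul_assoc, ← this, mul_assoc (K r * Ap r), Kinv_K, mul_one]
theorem K_Am (r : ℂˣ) : K r * Am r = (r : ℂ)⁻¹ • (Am r * K r) := by
  have := RingQuot.mkAlgHom_rel ℂ (Rel.K_Am (r := r))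
  simp only [map_mul, map_smul] at this
  change K r * Am r * Kinv r = (r : ℂ)⁻¹ • Am r at this
  rw [← smul_mul_assoc, ← this, mul_assoc (K r * Am r), Kinv_K, mul_one]
theorem Kinv_Ap (r : ℂˣ) : Kinv r * Ap r = (r : ℂ)⁻¹ • (Ap r * Kinv r) := by
  have h : Ap r * Kinv r = (r : ℂ) • (Kinv r * Ap r) := by
    calc Ap r * Kinv r = Kinv r * (K r * Ap r) * Kinv r := by
          rw [← mul_assoc (Kinv r), Kinv_K, one_mul]
      _ = _ := by
          rw [K_Ap, mul_smul_comm, smul_mul_assoc, mul_assoc (Kinv r), mul_assoc (Ap r), K_Kinv,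
            mul_one]
  rw [h, smul_smul, inv_mul_cancel₀ r.ne_zero, one_smul]
theorem Kinv_Am (r : ℂˣ) : Kinv r * Am r = (r : ℂ) • (Am r * Kinv r) := by
  have h : Am r * Kinv r = (r : ℂ)⁻¹ • (Kinv r * Am r) := by
    calc Am r * Kinv r = Kinv r * (K r * Am r) * Kinv r := by
          rw [← mul_assoc (Kinv r), Kinv_K, one_mul]
      _ = _ := by
          rw [K_Am, mul_smul_comm, smul_mul_assoc, mul_assoc (Kinv r), mul_assoc (Am r), K_Kinv,
            mul_one]
  rw [h, smul_smul, mul_inv_cancel₀ r.ne_zero, one_smul]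
theorem Am_Ap (r : ℂˣ) : Am r * Ap r =
    -(Ap r * Am r) + ((r : ℂ) - (r : ℂ)⁻¹)⁻¹ • (K r * K r - Kinv r * Kinv r) := by
  have := RingQuot.mkAlgHom_rel ℂ (Rel.Ap_Am (r := r))
  simp only [map_add, map_mul, map_smul, map_sub, pow_two] at this
  change Ap r * Am r + Am r * Ap r =
    ((r : ℂ) - (r : ℂ)⁻¹)⁻¹ • (K r * K r - Kinv r * Kinv r) at this
  rw [← this]; abel

/-- Moving a left factor past a product, used to normalise words. -/
theorem push {R : Type*} [Ring R] {a b c : R} (h : a * b = c) (x : R) : a * (b * x) = c * x := by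
  rw [← mul_assoc, h]

/-- Values of the coproduct on the generators. -/
def comulGen (r : ℂˣ) : Gen → Osp r ⊗[ℂ] Osp r
  | Gen.Ap => Ap r ⊗ₜ (K r * P r) + Kinv r ⊗ₜ Ap r
  | Gen.Am => Am r ⊗ₜ (K r * P r) + Kinv r ⊗ₜ Am r
  | Gen.K => K r ⊗ₜ K r
  | Gen.Kinv => Kinv r ⊗ₜ Kinv r
  | Gen.P => P r ⊗ₜ P r

theorem comul_rel (r : ℂˣ) ⦃x y : FreeAlgebra ℂ Gen⦄ (h : Rel r x y) :
    FreeAlgebra.lift ℂ (comulGen r) x = FreeAlgebra.lift ℂ (comulGen r) y := by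
  have hr := r.ne_zero
  cases h <;>
  simp only [map_mul, map_add, map_sub, map_smul, map_one, map_zero, map_neg, map_pow, pow_two,
    FreeAlgebra.lift_ι_apply, comulGen, mul_add, add_mul, Algebra.TensorProduct.tmul_mul_tmul,
    mul_assoc, K_Kinv, Kinv_K, P_P, P_K, P_Kinv, P_Ap, P_Am, K_Ap, K_Am, Kinv_Ap, Kinv_Am,
    Am_Ap, push (K_Kinv r), push (Kinv_K r), push (P_P r), push (P_K r), push (P_Kinv r),
    push (P_Ap r), push (P_Am r), push (K_Ap r), push (K_Am r), push (Kinv_Ap r),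
    push (Kinv_Am r), mul_neg, neg_mul, smul_mul_assoc, mul_smul_comm, mul_one, one_mul,
    TensorProduct.tmul_smul, TensorProduct.smul_tmul', TensorProduct.tmul_neg,
    TensorProduct.neg_tmul, smul_neg, smul_add, smul_sub, smul_smul,
    TensorProduct.tmul_add, TensorProduct.add_tmul, TensorProduct.tmul_sub,
    TensorProduct.sub_tmul, Algebra.TensorProduct.one_def] <;>
  try abel

/-- The coproduct `Δ` of `osp_q(1|2)`, for the ungraded product on the tensor square. -/
def comul (r : ℂˣ) : Osp r →ₐ[ℂ] Osp r ⊗[ℂ] Osp r :=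
  RingQuot.liftAlgHom ℂ ⟨FreeAlgebra.lift ℂ (comulGen r), comul_rel r⟩

theorem comul_gen (r : ℂˣ) (g : Gen) : comul r (gen r g) = comulGen r g := by
  have := RingQuot.liftAlgHom_mkAlgHom_apply (S := ℂ) (FreeAlgebra.lift ℂ (comulGen r))
    (comul_rel r) (FreeAlgebra.ι ℂ g)
  rw [FreeAlgebra.lift_ι_apply] at this
  exact this

/-- The parameter `q`, the square of the chosen `r = q ^ (1/2)`. -/
def qq (r : ℂˣ) : ℂ := (r : ℂ) ^ 2

/-- The `q`-number `[1/2]_q`. -/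
def qHalf (r : ℂˣ) : ℂ := ((r : ℂ) - (r : ℂ)⁻¹) / (qq r - (qq r)⁻¹)

/-- The Casimir operator of `osp_q(1|2)`. -/
def casimir (r : ℂˣ) : Osp r :=
  (-(Ap r * Am r) +
    (qq r - (qq r)⁻¹)⁻¹ • ((r : ℂ)⁻¹ • K r ^ 2 - (r : ℂ) • Kinv r ^ 2)) * P r

/-- The subalgebra generated by `A₋K`, `A₊K`, `K²P` and the Casimir operator. -/
def coidealAlg (r : ℂˣ) : Subalgebra ℂ (Osp r) :=
  Algebra.adjoin ℂ {Am r * K r, Ap r * K r, K r ^ 2 * P r, casimir r}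

/-- The generator `A₋K` as an element of the subalgebra. -/
def genE (r : ℂˣ) : coidealAlg r := ⟨Am r * K r, Algebra.subset_adjoin (by simp)⟩
/-- The generator `A₊K` as an element of the subalgebra. -/
def genF (r : ℂˣ) : coidealAlg r := ⟨Ap r * K r, Algebra.subset_adjoin (by simp)⟩
/-- The generator `K²P` as an element of the subalgebra. -/
def genC (r : ℂˣ) : coidealAlg r := ⟨K r ^ 2 * P r, Algebra.subset_adjoin (by simp)⟩
/-- The generator given by the Casimir operator as an element of the subalgebra. -/
def genG (r : ℂˣ) : coidealAlg r := ⟨casimir r, Algebra.subset_adjoin (by simp)⟩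

/-- The inclusion of `osp_q(1|2) ⊗ coidealAlg` into the tensor square. -/
def inclAlg (r : ℂˣ) : Osp r ⊗[ℂ] coidealAlg r →ₐ[ℂ] Osp r ⊗[ℂ] Osp r :=
  Algebra.TensorProduct.map (AlgHom.id ℂ (Osp r)) (coidealAlg r).val

theorem inclAlg_injective (r : ℂˣ) : Function.Injective (inclAlg r) :=
  Module.Flat.lTensor_preserves_injective_linearMap (M := Osp r)
    (coidealAlg r).val.toLinearMap Subtype.val_injective

theorem comul_casimir (r : ℂˣ) : comul r (casimir r) = inclAlg r
    (-(r : ℂ) • ((Am r * Kinv r * P r) ⊗ₜ genF r)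
      + (r : ℂ)⁻¹ • ((Ap r * Kinv r * P r) ⊗ₜ genE r)
      + qHalf r • ((Kinv r ^ 2 * P r) ⊗ₜ genC r)
      + casimir r ⊗ₜ genC r + (Kinv r ^ 2 * P r) ⊗ₜ genG r) := by
  have hr := r.ne_zero
  have hc : comul r (casimir r) = (-(comulGen r .Ap * comulGen r .Am) +
      (qq r - (qq r)⁻¹)⁻¹ • ((r : ℂ)⁻¹ • comulGen r .K ^ 2 - (r : ℂ) • comulGen r .Kinv ^ 2)) *
      comulGen r .P := by
    simp only [← comul_gen, ← map_mul, ← map_pow, ← map_smul, ← map_sub, ← map_neg, ← map_add]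
    rfl
  rw [hc]
  simp only [inclAlg, Algebra.TensorProduct.map_tmul, AlgHom.coe_id, id_eq, Subalgebra.coe_val,
    genE, genF, genC, genG, casimir, comulGen, qHalf, div_eq_mul_inv,
    map_mul, map_add, map_sub, map_smul, map_one, map_zero, map_neg, map_pow, pow_two,
    mul_add, add_mul, mul_sub, sub_mul, Algebra.TensorProduct.tmul_mul_tmul,
    mul_assoc, K_Kinv, Kinv_K, P_P, P_K, P_Kinv, P_Ap, P_Am, K_Ap, K_Am, Kinv_Ap, Kinv_Am,
    push (K_Kinv r), push (Kinv_K r), push (P_P r), push (P_K r), push (P_Kinv r),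
    push (P_Ap r), push (P_Am r), push (K_Ap r), push (K_Am r), push (Kinv_Ap r),
    push (Kinv_Am r), mul_neg, neg_mul, smul_mul_assoc, mul_smul_comm, mul_one, one_mul,
    TensorProduct.tmul_smul, ← TensorProduct.smul_tmul', TensorProduct.tmul_neg,
    TensorProduct.neg_tmul, smul_neg, smul_add, smul_sub, smul_smul,
    TensorProduct.tmul_add, TensorProduct.add_tmul, TensorProduct.tmul_sub,
    TensorProduct.sub_tmul]
  match_scalars <;> (try field_simp) <;> ring

/-- The subalgebra is a left coideal. -/
theorem comul_mem (r : ℂˣ) (x : coidealAlg r) : comul r x ∈ (inclAlg r).range := by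
  suffices h : coidealAlg r ≤ (inclAlg r).range.comap (comul r) from h x.2
  refine Algebra.adjoin_le ?_
  rintro y (rfl | rfl | rfl | rfl)
  · refine ⟨(Am r * K r) ⊗ₜ genC r + 1 ⊗ₜ genE r, ?_⟩
    have : comul r (Am r * K r) = comulGen r .Am * comulGen r .K := by
      rw [← comul_gen, ← comul_gen, ← map_mul]; rfl
    change inclAlg r _ = comul r _
    rw [this]
    simp [inclAlg, genC, genE, comulGen, add_mul, mul_assoc, P_K, Kinv_K, pow_two]
  · refine ⟨(Ap r * K r) ⊗ₜ genC r + 1 ⊗ₜ genF r, ?_⟩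
    have : comul r (Ap r * K r) = comulGen r .Ap * comulGen r .K := by
      rw [← comul_gen, ← comul_gen, ← map_mul]; rfl
    change inclAlg r _ = comul r _
    rw [this]
    simp [inclAlg, genC, genF, comulGen, add_mul, mul_assoc, P_K, Kinv_K, pow_two]
  · refine ⟨(K r ^ 2 * P r) ⊗ₜ genC r, ?_⟩
    have : comul r (K r ^ 2 * P r) = comulGen r .K ^ 2 * comulGen r .P := by
      rw [← comul_gen, ← comul_gen, ← map_pow, ← map_mul]; rfl
    change inclAlg r _ = comul r _
    rw [this]
    simp [inclAlg, genC, comulGen, pow_two]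
  · exact ⟨_, (comul_casimir r).symm⟩

/-- The coproduct, restricted to `coidealAlg → osp_q(1|2) ⊗ coidealAlg`. -/
def comulI (r : ℂˣ) : coidealAlg r →ₐ[ℂ] Osp r ⊗[ℂ] coidealAlg r :=
  (AlgEquiv.ofInjective (inclAlg r) (inclAlg_injective r)).symm.toAlgHom.comp
    (((comul r).comp (coidealAlg r).val).codRestrict (inclAlg r).range (comul_mem r))

theorem inclAlg_comulI (r : ℂˣ) (x : coidealAlg r) : inclAlg r (comulI r x) = comul r x := by
  have := (AlgEquiv.ofInjective (inclAlg r) (inclAlg_injective r)).apply_symm_apply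
    ⟨comul r x, comul_mem r x⟩
  exact congrArg Subtype.val this

/-- The defining formulas of the coaction `τ` on the four generators of the subalgebra. -/
structure IsCoaction (r : ℂˣ) (t : coidealAlg r →ₐ[ℂ] Osp r ⊗[ℂ] coidealAlg r) : Prop where
  map_E : t (genE r) = (K r ^ 2 * P r) ⊗ₜ genE r
  map_F : t (genF r) = (Kinv r ^ 2 * P r) ⊗ₜ genF r
    + ((r : ℂ)⁻¹ * (qq r - (qq r)⁻¹)) • ((Ap r ^ 2 * P r) ⊗ₜ genE r)
    + ((r : ℂ)⁻¹ * ((r : ℂ) - (r : ℂ)⁻¹)) • ((Ap r * Kinv r * P r) ⊗ₜ genC r)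
    + ((r : ℂ)⁻¹ * (qq r - (qq r)⁻¹)) • ((Ap r * Kinv r * P r) ⊗ₜ genG r)
  map_C : t (genC r) = 1 ⊗ₜ genC r - (qq r - (qq r)⁻¹) • ((Ap r * K r) ⊗ₜ genE r)
  map_G : t (genG r) = 1 ⊗ₜ genG r

/-- An algebra morphism on the subalgebra is determined by its values on the generators. -/
theorem IsCoaction.unique {r : ℂˣ} {t t' : coidealAlg r →ₐ[ℂ] Osp r ⊗[ℂ] coidealAlg r}
    (h : IsCoaction r t) (h' : IsCoaction r t') : t = t' := by
  refine AlgHom.adjoin_ext ?_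
  rintro x (rfl | rfl | rfl | rfl)
  · exact h.map_E.trans h'.map_E.symm
  · exact h.map_F.trans h'.map_F.symm
  · exact h.map_C.trans h'.map_C.symm
  · exact h.map_G.trans h'.map_G.symm

instance (r : ℂˣ) : Nonempty (coidealAlg r →ₐ[ℂ] Osp r ⊗[ℂ] coidealAlg r) :=
  ⟨Algebra.TensorProduct.includeRight⟩

/-- The coaction `τ`: the algebra morphism `coidealAlg → osp_q(1|2) ⊗ coidealAlg` with the
prescribed values on the generators (unique by `IsCoaction.unique`). -/
def tau (r : ℂˣ) : coidealAlg r →ₐ[ℂ] Osp r ⊗[ℂ] coidealAlg r :=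
  Classical.epsilon (IsCoaction r)

/-- The `k`-fold tensor product of `osp_q(1|2)` with its slotwise product. -/
abbrev Tens (r : ℂˣ) (k : ℕ) : Type := ⨂[ℂ] _ : Fin k, Osp r

/-- The identification of `osp^{⊗k} ⊗ osp` with `osp^{⊗(k+1)}`, appending a last slot. -/
def snoc (r : ℂˣ) (k : ℕ) : Tens r k ⊗[ℂ] Osp r ≃ₗ[ℂ] Tens r (k + 1) :=
  (TensorProduct.congr (LinearEquiv.refl ℂ (Tens r k))
    (PiTensorProduct.subsingletonEquiv (R := ℂ) (s := fun _ : Fin 1 => Osp r) 0).symm).trans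
    (TensorPower.mulEquiv (R := ℂ) (M := Osp r) (n := k) (m := 1))

theorem snoc_tprod (r : ℂˣ) (k : ℕ) (a : Fin k → Osp r) (x : Osp r) :
    snoc r k (PiTensorProduct.tprod ℂ a ⊗ₜ x) =
      PiTensorProduct.tprod ℂ (Fin.snoc (α := fun _ => Osp r) a x) := by
  simp only [snoc, LinearEquiv.trans_apply, TensorProduct.congr_tmul, LinearEquiv.refl_apply,
    PiTensorProduct.subsingletonEquiv_symm_apply']
  rw [← TensorPower.gMul_def, TensorPower.tprod_mul_tprod, Fin.append_right_eq_snoc]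

/-- `1 ⊗ ⋯ ⊗ 1 ⊗ φ` on `osp^{⊗k} ⊗ coidealAlg`, where `φ` acts on the last slot. -/
def onLast (r : ℂˣ) (φ : coidealAlg r →ₐ[ℂ] Osp r ⊗[ℂ] coidealAlg r) (k : ℕ) :
    Tens r k ⊗[ℂ] coidealAlg r →ₗ[ℂ] Tens r (k + 1) ⊗[ℂ] coidealAlg r :=
  (snoc r k).toLinearMap.rTensor (coidealAlg r) ∘ₗ
    (TensorProduct.assoc ℂ (Tens r k) (Osp r) (coidealAlg r)).symm.toLinearMap ∘ₗ
    φ.toLinearMap.lTensor (Tens r k)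

/-- `1 ⊗ ⋯ ⊗ 1 ⊗ Δ : osp^{⊗(k+1)} → osp^{⊗(k+2)}`. -/
def comulLast (r : ℂˣ) (k : ℕ) : Tens r (k + 1) →ₗ[ℂ] Tens r (k + 2) :=
  (snoc r (k + 1)).toLinearMap ∘ₗ (snoc r k).toLinearMap.rTensor (Osp r) ∘ₗ
    (TensorProduct.assoc ℂ (Tens r k) (Osp r) (Osp r)).symm.toLinearMap ∘ₗ
    (comul r).toLinearMap.lTensor (Tens r k) ∘ₗ (snoc r k).symm.toLinearMap

/-- A stage of the extension process: an element of `osp^{⊗k} ⊗ coidealAlg` for some `k`. -/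
abbrev Stage (r : ℂˣ) : Type := Σ k : ℕ, Tens r k ⊗[ℂ] coidealAlg r

open Classical in
/-- The extension morphism `τ_{k-1,k}^A`, where `prev` means `k - 1 ∈ A` and `cur` means `k ∈ A`.
The first slots that are not yet touched hold `1` and are carried along.  (The value for a stage
with no slot in front of the last one, when neither index lies in `A`, is never used.) -/
def extend (r : ℂˣ) (prev cur : Prop) : Stage r → Stage r
  | ⟨k, x⟩ =>
    if prev then
      if cur then ⟨k + 1, onLast r (comulI r) k x⟩
      else ⟨k + 2, onLast r (tau r) (k + 1) (onLast r (comulI r) k x)⟩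
    else
      if cur then ⟨k, x⟩
      else match k, x with
        | 0, x => ⟨0, x⟩
        | k + 1, x => ⟨k + 2, (comulLast r k).rTensor (coidealAlg r) x⟩

/-- Forget that the last slot lies in the subalgebra. -/
def stageVal (r : ℂˣ) (s : Stage r) : Tens r (s.1 + 1) :=
  snoc r s.1 ((coidealAlg r).val.toLinearMap.lTensor (Tens r s.1) s.2)

/-- `x ↦ x ⊗ 1 ⊗ ⋯ ⊗ 1 ∈ osp^{⊗n}` for `x ∈ osp^{⊗k}` and `k ≤ n` (and `0` if `n < k`). -/
def padRight (r : ℂˣ) (n k : ℕ) (x : Tens r k) : Tens r n :=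
  if h : k ≤ n then
    TensorPower.cast ℂ (Osp r) (Nat.add_sub_of_le h)
      (TensorPower.mulEquiv (R := ℂ) (M := Osp r) (n := k) (m := n - k)
        (x ⊗ₜ[ℂ] (1 : Tens r (n - k))))
  else 0

/-- The stage reached after applying the extension morphisms `τ_{k-1,k}^A`, in order of increasing
`k = lo + 1, …, hi`, to `1 ⊗ ⋯ ⊗ 1 ⊗ Γ` (with `lo - 1` leading slots). -/
def stage (r : ℂˣ) (A : Finset ℕ) (lo hi : ℕ) : Stage r :=
  (List.range' (lo + 1) (hi - lo)).foldl
    (fun s k => extend r (k - 1 ∈ A) (k ∈ A) s)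
    ⟨lo - 1, (1 : Tens r (lo - 1)) ⊗ₜ[ℂ] genG r⟩

/-- The operator `Γ_A ∈ osp^{⊗n}` attached to a set `A ⊆ {1, …, n}`: the stage with `lo = min A`
and `hi = max A`, padded with `n - max A` units on the right; `Γ_∅ = -[1/2]_q`. -/
def Gam (r : ℂˣ) (n : ℕ) (A : Finset ℕ) : Tens r n :=
  if h : A.Nonempty then
    let s := stage r A (A.min' h) (A.max' h)
    padRight r n (s.1 + 1) (stageVal r s)
  else algebraMap ℂ (Tens r n) (-qHalf r)

/-- The cubic element `C_m` of `osp^{⊗n}`. -/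
def casimirC (r : ℂˣ) (n m : ℕ) : Tens r n :=
  let s : ℂ := (r : ℂ)
  let G : Finset ℕ → Tens r n := Gam r n
  let X := G {m, m + 1}
  let Y := G (Finset.Icc 1 (m - 1) ∪ {m + 1})
  let Z := G (Finset.Icc 1 m)
  let L := G (Finset.Icc 1 (m - 1))
  let T := G (Finset.Icc 1 (m + 1))
  (s⁻¹ - s ^ 3) • (X * Y * Z)
    + qq r • X ^ 2 + (qq r)⁻¹ • Y ^ 2 + qq r • Z ^ 2
    - (s⁻¹ - s ^ 3) • ((G {m} * G {m + 1} + L * T) * X)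
    - (s⁻¹ - s ^ 3) • ((G {m} * L + G {m + 1} * T) * Z)
    - (s - (s ^ 3)⁻¹) • ((G {m + 1} * L + G {m} * T) * Y)

/-- The subalgebra generated by `Γ_[m]`, `Γ_{m,m+1}` and `Γ_{[1;m-1] ∪ {m+1}}`. -/
def rankOneAlg (r : ℂˣ) (n m : ℕ) : Subalgebra ℂ (Tens r n) :=
  Algebra.adjoin ℂ {Gam r n (Finset.Icc 1 m), Gam r n {m, m + 1},
    Gam r n (Finset.Icc 1 (m - 1) ∪ {m + 1})}

end QBI

end

/-! The whole statement takes place in three tensor legs. Write X, Y, Z for the operators of {m,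
m+1}, [1;m-1] ∪ {m+1} and [m], and L, M, N, T for those of [m-1], {m}, {m+1} and [m+1]. By
coassociativity the first m - 1 slots enter only through an iterated coproduct D, so all seven
operators are values of the algebra morphism f(a,b,c) = D(a) · b in slot m · c in slot m+1
(`exists_isTriHom`).

The computation uses only a few relations. Put E = (q - q⁻¹)A₋K, F = A₊K, C = K²P, G = (q - q⁻¹)Γ
and c = C⁻¹. Then G is central, C commutes with E and F up to scalars, and EF and FE are polynomials
in C and G. Every word therefore has a normal form, a power of E or F followed by powers of C or c
and of G, and an identity between the seven operators reduces to comparing coefficients. This yields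
the q-anticommutators of X, Y, Z (`qAnticommutators`), the commutation of L, M, N, T with X and Z
(`commute_cas`), and the closed formula (`casimir_identity`). Commutation with Y follows because an
anticommutator expresses Y through X, Z, L, M, N, T. So C_m, a polynomial in L, M, N, T, is central.
It lies in the subalgebra because the anticommutators also express ML + NT, MN + LT and NL + MT
through X, Y, Z.

The coaction `tau` is obtained by choice, so its existence must be proved. Its prescribed values
satisfy the same relations (`GWRel.tau`); what remains is that these relations present the coideal
subalgebra. The normal words span the presented algebra, and weighted shift representations show
that their images in `Osp r` are linearly independent. -/

noncomputable section

namespace QBI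

/-! ### Relations of generalised Weyl type and their stability under the coaction -/

/-- The relations between `(q - q⁻¹) A₋K`, `A₊K`, `K²P` and `(q - q⁻¹) Γ`, where `q = r ^ 2`. -/
structure GWRel {A : Type*} [Ring A] [Algebra ℂ A] (r : ℂ) (E F C G : A) : Prop where
  GE : G * E = E * G
  GF : G * F = F * G
  GC : G * C = C * G
  CE : C * E = (-r⁻¹ ^ 2) • (E * C)
  CF : C * F = (-r ^ 2) • (F * C)
  EF : E * F = r • (C * G) + r ^ 2 • (C * C) - 1
  FE : F * E = (-r⁻¹) • (C * G) + r⁻¹ ^ 2 • (C * C) - 1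

/-- The relations satisfied by an inverse `c` of `C`. -/
structure GWInv {A : Type*} [Ring A] [Algebra ℂ A] (r : ℂ) (E F C G c : A) : Prop
    extends GWRel r E F C G where
  Cc : C * c = 1
  cC : c * C = 1
  Gc : G * c = c * G
  cE : c * E = (-r ^ 2) • (E * c)
  cF : c * F = (-r⁻¹ ^ 2) • (F * c)

section
variable {A B : Type*} [Ring A] [Algebra ℂ A] [Ring B] [Algebra ℂ B] {r : ℂ}
  {E F C G c : A} {E' F' C' G' : B}

/-- The four elements are the prescribed images under the coaction, rescaled. Each relation is
checked by normal ordering both legs separately. With `GWRel.exists_lift` this defines the coaction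
on the presented algebra. -/
theorem GWRel.tau (hr : r ≠ 0) (h : GWInv r E F C G c) (h' : GWRel r E' F' C' G') :
    GWRel r (C ⊗ₜ[ℂ] E')
      (c ⊗ₜ[ℂ] F' + r⁻¹ ^ 2 • ((F * F * c) ⊗ₜ[ℂ] E') + (1 - r⁻¹ ^ 2) • ((F * c) ⊗ₜ[ℂ] C')
        + r⁻¹ • ((F * c) ⊗ₜ[ℂ] G'))
      (1 ⊗ₜ[ℂ] C' - F ⊗ₜ[ℂ] E') (1 ⊗ₜ[ℂ] G') := by
  obtain ⟨⟨GE, GF, GC, CE, CF, EF, FE⟩, Cc, cC, Gc, cE, cF⟩ := h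
  obtain ⟨GE', GF', GC', CE', CF', EF', FE'⟩ := h'
  constructor <;>
  simp only [mul_add, add_mul, mul_sub, sub_mul, Algebra.TensorProduct.tmul_mul_tmul, mul_assoc,
    GE, GF, GC, CE, CF, EF, FE, Cc, cC, Gc, cE, cF, GE', GF', GC', CE', CF', EF', FE',
    push GE, push GF, push GC, push CE, push CF, push EF, push FE, push Cc, push cC, push Gc,
    push cE, push cF, push GE', push GF', push GC', push CE', push CF', push EF', push FE',
    mul_neg, neg_mul, smul_mul_assoc, mul_smul_comm, mul_one, one_mul,
    TensorProduct.tmul_smul, ← TensorProduct.smul_tmul', TensorProduct.tmul_neg,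
    TensorProduct.neg_tmul, smul_neg, smul_add, smul_sub, smul_smul,
    TensorProduct.tmul_add, TensorProduct.add_tmul, TensorProduct.tmul_sub,
    TensorProduct.sub_tmul, Algebra.TensorProduct.one_def] <;>
  match_scalars <;> (try field_simp) <;> ring
end

/-! ### Casimir elements in three slots and the identities between them -/

/-- A unital multiplicative trilinear map, that is, an algebra morphism from `A ⊗ A ⊗ A`. -/
structure IsTriHom {A R : Type*} [Ring A] [Algebra ℂ A] [Ring R] [Algebra ℂ R]
    (f : A → A → A → R) : Prop where
  one : f 1 1 1 = 1
  mul (a b c a' b' c' : A) : f a b c * f a' b' c' = f (a * a') (b * b') (c * c')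
  add_left (a a' b c : A) : f (a + a') b c = f a b c + f a' b c
  add_mid (a b b' c : A) : f a (b + b') c = f a b c + f a b' c
  add_right (a b c c' : A) : f a b (c + c') = f a b c + f a b c'
  smul_left (t : ℂ) (a b c : A) : f (t • a) b c = t • f a b c
  smul_mid (t : ℂ) (a b c : A) : f a (t • b) c = t • f a b c
  smul_right (t : ℂ) (a b c : A) : f a b (t • c) = t • f a b c

section
variable {A R : Type*} [Ring A] [Algebra ℂ A] [Ring R] [Algebra ℂ R] {r : ℂ} {E F C G c : A}
  {f : A → A → A → R}

variable (r E F C G c f)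

/-- The Casimir element on the first and second slots. -/
def cas12 : R :=
  (-r) • f (E * c) F 1 + r⁻¹ • f (F * c) E 1 + (r - r⁻¹) • f c C 1 + f G C 1 + f c G 1

/-- The Casimir element on the second and third slots. -/
def cas23 : R :=
  (-r) • f 1 (E * c) F + r⁻¹ • f 1 (F * c) E + (r - r⁻¹) • f 1 c C + f 1 G C + f 1 c G

/-- The twisted Casimir element on the first and third slots. -/
def cas13 : R :=
  (-r) • (f (E * c) c F + r⁻¹ ^ 2 • f (E * c) (F * F * c) E + (1 - r⁻¹ ^ 2) • f (E * c) (F * c) C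
      + r⁻¹ • f (E * c) (F * c) G)
    + r⁻¹ • f (F * c) C E + (r - r⁻¹) • (f c 1 C + (-1 : ℂ) • f c F E)
    + (f G 1 C + (-1 : ℂ) • f G F E) + f c 1 G

/-- The Casimir element on all three slots. -/
def cas123 : R :=
  (-r) • (f (E * c) F C + f (E * c) 1 F) + r⁻¹ • (f (F * c) E C + f (F * c) 1 E)
    + (r - r⁻¹) • f c C C + f G C C
    + ((-r) • f c (E * c) F + r⁻¹ • f c (F * c) E + (r - r⁻¹) • f c c C + f c G C + f c c G)

variable {r E F C G c f}

set_option maxHeartbeats 4000000 in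
/-- The `q`-anticommutation relations between the intermediate Casimir elements. -/
theorem qAnticommutators (hr : r ≠ 0) (h : GWInv r E F C G c) (hf : IsTriHom f)
    {X Y Z T L M N : R} (hX : X = cas23 r E F C G c f) (hY : Y = cas13 r E F C G c f)
    (hZ : Z = cas12 r E F C G c f) (hT : T = cas123 r E F C G c f) (hL : L = f G 1 1)
    (hM : M = f 1 G 1) (hN : N = f 1 1 G) :
    r • (X * Y) + r⁻¹ • (Y * X) = (r ^ 2 - r⁻¹ ^ 2) • Z + (r + r⁻¹) • (M * L + N * T) ∧
    r • (Y * Z) + r⁻¹ • (Z * Y) = (r ^ 2 - r⁻¹ ^ 2) • X + (r + r⁻¹) • (M * N + L * T) ∧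
    r • (Z * X) + r⁻¹ • (X * Z) = (r ^ 2 - r⁻¹ ^ 2) • Y + (r + r⁻¹) • (N * L + M * T) := by
  obtain ⟨⟨GE, GF, GC, CE, CF, EF, FE⟩, Cc, cC, Gc, cE, cF⟩ := h
  obtain ⟨one, mul, al, am, ar, sl, sm, sr⟩ := hf
  -- `IsTriHom` records additivity and homogeneity but not subtraction, so the constant term -1 is
  -- turned into a scalar multiple of 1.
  rw [sub_eq_add_neg, ← neg_one_smul ℂ (1 : A)] at EF FE
  subst hX hY hZ hT hL hM hN
  refine ⟨?_, ?_, ?_⟩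
  all_goals
    simp only [cas12, cas13, cas23, cas123, ← one, mul_add, add_mul, mul, al, am, ar, sl,
      sm, sr, mul_assoc, GE, GF, GC, CE, CF, EF, FE, Cc, cC, Gc, cE, cF,
      push GE, push GF, push GC, push CE, push CF, push EF, push FE, push Cc, push cC, push Gc,
      push cE, push cF, smul_mul_assoc, mul_smul_comm, mul_one, one_mul, smul_add, smul_smul]
    match_scalars <;> (try field_simp) <;> ring

set_option maxHeartbeats 4000000 in
/-- The Casimir elements of the single slots and of all three slots commute with each other and
with those of the pairs of neighbouring slots. -/
theorem commute_cas (hr : r ≠ 0) (h : GWInv r E F C G c) (hf : IsTriHom f)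
    {X Z : R} (hX : X = cas23 r E F C G c f) (hZ : Z = cas12 r E F C G c f) {S : R}
    (hS : S ∈ ({f G 1 1, f 1 G 1, f 1 1 G, cas123 r E F C G c f} : Set R)) :
    Commute S X ∧ Commute S Z ∧ Commute S (f G 1 1) ∧ Commute S (f 1 G 1) ∧
      Commute S (f 1 1 G) := by
  obtain ⟨⟨GE, GF, GC, CE, CF, EF, FE⟩, Cc, cC, Gc, cE, cF⟩ := h
  obtain ⟨one, mul, al, am, ar, sl, sm, sr⟩ := hf
  rw [sub_eq_add_neg, ← neg_one_smul ℂ (1 : A)] at EF FE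
  subst hX hZ
  rcases hS with rfl | rfl | rfl | rfl
  all_goals
    refine ⟨?_, ?_, ?_, ?_, ?_⟩ <;> rw [commute_iff_eq]
  all_goals
    simp only [cas12, cas13, cas23, cas123, ← one, mul_add, add_mul, mul, al, am, ar, sl,
      sm, sr, mul_assoc, GE, GF, GC, CE, CF, EF, FE, Cc, cC, Gc, cE, cF,
      push GE, push GF, push GC, push CE, push CF, push EF, push FE, push Cc, push cC, push Gc,
      push cE, push cF, smul_mul_assoc, mul_smul_comm, mul_one, one_mul, smul_add, smul_smul]
    try match_scalars <;> (try field_simp) <;> ring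

end

section
variable {A R : Type*} [Ring A] [Algebra ℂ A] [Ring R] [Algebra ℂ R] {r : ℂ} {E F C G c : A}
  {f : A → A → A → R}

-- The closed formula for C_m, multiplied by (q - q⁻¹)² and written in the rescaled operators: the
-- constant q/(1+q)² becomes (r - r⁻¹)². Once every slot is normally ordered, both sides are
-- combinations of the same values of `f` and the coefficients agree.
set_option maxHeartbeats 40000000 in
theorem casimir_identity (hr : r ≠ 0) (h : GWInv r E F C G c) (hf : IsTriHom f)
    {X Y Z T L M N : R} (hX : X = cas23 r E F C G c f) (hY : Y = cas13 r E F C G c f)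
    (hZ : Z = cas12 r E F C G c f) (hT : T = cas123 r E F C G c f) (hL : L = f G 1 1)
    (hM : M = f 1 G 1) (hN : N = f 1 1 G) :
    (-r) • (X * (Y * Z)) + r ^ 2 • (X * X) + r⁻¹ ^ 2 • (Y * Y) + r ^ 2 • (Z * Z)
      + r • (M * (N * X)) + r • (L * (T * X)) + r • (M * (L * Z)) + r • (N * (T * Z))
      + (-r⁻¹) • (N * (L * Y)) + (-r⁻¹) • (M * (T * Y)) + (r - r⁻¹) ^ 2 • 1 + M * (N * (L * T))
      = L * L + M * M + N * N + T * T := by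
  obtain ⟨⟨GE, GF, GC, CE, CF, EF, FE⟩, Cc, cC, Gc, cE, cF⟩ := h
  obtain ⟨one, mul, al, am, ar, sl, sm, sr⟩ := hf
  rw [sub_eq_add_neg, ← neg_one_smul ℂ (1 : A)] at EF FE
  subst hX hY hZ hT hL hM hN
  simp only [cas12, cas13, cas23, cas123, ← one, mul_add, add_mul, mul, al, am, ar, sl,
    sm, sr, mul_assoc, GE, GF, GC, CE, CF, EF, FE, Cc, cC, Gc, cE, cF,
    push GE, push GF, push GC, push CE, push CF, push EF, push FE, push Cc, push cC, push Gc,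
    push cE, push cF, smul_mul_assoc, mul_smul_comm, mul_one, one_mul, smul_add, smul_smul]
  match_scalars <;> (try field_simp) <;> ring
end

/-! ### Spanning monomials and the presented algebra -/

section Spanning
variable {A : Type*} [Ring A] [Algebra ℂ A] {r : ℂ} {E F C G : A}

/-- The powers of `E` and of `F`, indexed by the integers. -/
def zPow (E F : A) : ℤ → A
  | .ofNat n => E ^ n
  | .negSucc n => F ^ (n + 1)

/-- The monomials that span an algebra with the relations `GWRel`. -/
def normalMonomial (E F C G : A) (x : ℤ × ℕ × ℕ) : A := zPow E F x.1 * (C ^ x.2.1 * G ^ x.2.2)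

theorem smul_commute_pow {x y : A} {a : ℂ} (h : x * y = a • (y * x)) (n : ℕ) :
    x * y ^ n = a ^ n • (y ^ n * x) := by
  induction n with
  | zero => simp
  | succ n ih =>
    rw [pow_succ, ← mul_assoc, ih, smul_mul_assoc, mul_assoc, h, mul_smul_comm, smul_smul,
      mul_assoc, pow_succ a]

theorem exists_smul_zPow {x y z : A} {a b : ℂ} (hy : x * y = a • (y * x)) (hz : x * z = b • (z * x))
    (w : ℤ) : ∃ e : ℂ, x * zPow y z w = e • (zPow y z w * x) := by
  cases w with
  | ofNat n => exact ⟨_, smul_commute_pow hy n⟩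
  | negSucc n => exact ⟨_, smul_commute_pow hz (n + 1)⟩

theorem mul_mem_span_of_forall {ι : Type*} {v : ι → A} {x s : A}
    (h : ∀ i, x * v i ∈ Submodule.span ℂ (Set.range v)) (hs : s ∈ Submodule.span ℂ (Set.range v)) :
    x * s ∈ Submodule.span ℂ (Set.range v) := by
  have : Submodule.span ℂ (Set.range v) ≤
      (Submodule.span ℂ (Set.range v)).comap (LinearMap.mulLeft ℂ x) := by
    rw [Submodule.span_le]
    rintro _ ⟨i, rfl⟩
    exact h i
  exact this hs

/-- The span contains 1 and is stable under left multiplication by each generator, hence by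
everything. `C` and `G` pass the power of `E` or `F` up to a scalar. `E` either lengthens a power of
`E` or meets an `F`, and then `EF` contracts to a polynomial in `C` and `G`; symmetrically for `F`.
-/
theorem GWRel.span_normalMonomial (h : GWRel r E F C G)
    (hgen : Algebra.adjoin ℂ {E, F, C, G} = ⊤) :
    Submodule.span ℂ (Set.range (normalMonomial E F C G)) = ⊤ := by
  set S := Submodule.span ℂ (Set.range (normalMonomial E F C G)) with hS
  have mem (w k l) : zPow E F w * (C ^ k * G ^ l) ∈ S :=
    Submodule.subset_span ⟨(w, k, l), rfl⟩
  have hGE : G * E = (1 : ℂ) • (E * G) := by rw [one_smul, h.GE]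
  have hGF : G * F = (1 : ℂ) • (F * G) := by rw [one_smul, h.GF]
  have hC : ∀ s ∈ S, C * s ∈ S := fun s hs => by
    refine mul_mem_span_of_forall ?_ hs
    rintro ⟨w, k, l⟩
    obtain ⟨e, he⟩ := exists_smul_zPow h.CE h.CF w
    rw [normalMonomial, ← mul_assoc, he, smul_mul_assoc, mul_assoc, ← mul_assoc C, ← pow_succ']
    exact S.smul_mem _ (mem _ _ _)
  have hG : ∀ s ∈ S, G * s ∈ S := fun s hs => by
    refine mul_mem_span_of_forall ?_ hs
    rintro ⟨w, k, l⟩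
    obtain ⟨e, he⟩ := exists_smul_zPow hGE hGF w
    have hc : G * C ^ k = C ^ k * G := (Commute.pow_right h.GC k)
    rw [normalMonomial, ← mul_assoc, he, smul_mul_assoc, mul_assoc, ← mul_assoc G, hc, mul_assoc,
      ← pow_succ']
    exact S.smul_mem _ (mem _ _ _)
  have hE : ∀ s ∈ S, E * s ∈ S := fun s hs => by
    refine mul_mem_span_of_forall ?_ hs
    rintro ⟨w, k, l⟩
    rw [normalMonomial]
    cases w with
    | ofNat n =>
      rw [← mul_assoc, show E * zPow E F (Int.ofNat n) = zPow E F (Int.ofNat (n + 1)) from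
        (pow_succ' E n).symm]
      exact mem _ _ _
    | negSucc n =>
      have hmem : F ^ n * (C ^ k * G ^ l) ∈ S := by
        cases n with
        | zero => simpa [zPow] using mem (.ofNat 0) k l
        | succ n => exact mem (.negSucc n) k l
      change E * (F ^ (n + 1) * (C ^ k * G ^ l)) ∈ S
      rw [pow_succ', mul_assoc F, ← mul_assoc E, h.EF, sub_mul, add_mul, smul_mul_assoc,
        smul_mul_assoc, one_mul, mul_assoc C G, mul_assoc C C]
      exact S.sub_mem (S.add_mem (S.smul_mem _ (hC _ (hG _ hmem))) (S.smul_mem _ (hC _ (hC _ hmem))))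
        hmem
  have hF : ∀ s ∈ S, F * s ∈ S := fun s hs => by
    refine mul_mem_span_of_forall ?_ hs
    rintro ⟨w, k, l⟩
    rw [normalMonomial]
    rcases w with (_ | n) | n
    · change F * (E ^ 0 * _) ∈ S
      rw [pow_zero, one_mul]
      simpa [zPow] using mem (.negSucc 0) k l
    · have hmem : E ^ n * (C ^ k * G ^ l) ∈ S := mem (.ofNat n) k l
      change F * (E ^ (n + 1) * (C ^ k * G ^ l)) ∈ S
      rw [pow_succ', mul_assoc E, ← mul_assoc F, h.FE, sub_mul, add_mul, smul_mul_assoc,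
        smul_mul_assoc, one_mul, mul_assoc C G, mul_assoc C C]
      exact S.sub_mem (S.add_mem (S.smul_mem _ (hC _ (hG _ hmem))) (S.smul_mem _ (hC _ (hC _ hmem))))
        hmem
    · rw [← mul_assoc, show F * zPow E F (Int.negSucc n) = zPow E F (Int.negSucc (n + 1)) from
        (pow_succ' F (n + 1)).symm]
      exact mem _ _ _
  have key : ∀ x : A, ∀ s ∈ S, x * s ∈ S := fun x => by
    have hx : x ∈ Algebra.adjoin ℂ {E, F, C, G} := hgen ▸ Algebra.mem_top
    induction hx using Algebra.adjoin_induction with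
    | mem x hx =>
      rcases hx with rfl | rfl | rfl | rfl
      exacts [hE, hF, hC, hG]
    | algebraMap a =>
      intro s hs
      rw [← Algebra.smul_def]
      exact S.smul_mem a hs
    | add x y _ _ hx hy => exact fun s hs => add_mul x y s ▸ S.add_mem (hx s hs) (hy s hs)
    | mul x y _ _ hx hy => exact fun s hs => mul_assoc x y s ▸ hx _ (hy s hs)
  refine eq_top_iff.2 fun x _ => ?_
  have h1 : (1 : A) ∈ S := by simpa [zPow] using mem (.ofNat 0) 0 0
  simpa using key x 1 h1

end Spanning

section Presentation
/-- The generators of the algebra presented by the relations `GWRel`. -/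
inductive PGen
  | E | F | C | G

open FreeAlgebra in
/-- The relations `GWRel`, in the free algebra. -/
inductive PRel (r : ℂ) : FreeAlgebra ℂ PGen → FreeAlgebra ℂ PGen → Prop
  | GE : PRel r (ι ℂ PGen.G * ι ℂ PGen.E) (ι ℂ PGen.E * ι ℂ PGen.G)
  | GF : PRel r (ι ℂ PGen.G * ι ℂ PGen.F) (ι ℂ PGen.F * ι ℂ PGen.G)
  | GC : PRel r (ι ℂ PGen.G * ι ℂ PGen.C) (ι ℂ PGen.C * ι ℂ PGen.G)
  | CE : PRel r (ι ℂ PGen.C * ι ℂ PGen.E) ((-r⁻¹ ^ 2) • (ι ℂ PGen.E * ι ℂ PGen.C))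
  | CF : PRel r (ι ℂ PGen.C * ι ℂ PGen.F) ((-r ^ 2) • (ι ℂ PGen.F * ι ℂ PGen.C))
  | EF : PRel r (ι ℂ PGen.E * ι ℂ PGen.F)
      (r • (ι ℂ PGen.C * ι ℂ PGen.G) + r ^ 2 • (ι ℂ PGen.C * ι ℂ PGen.C) - 1)
  | FE : PRel r (ι ℂ PGen.F * ι ℂ PGen.E)
      ((-r⁻¹) • (ι ℂ PGen.C * ι ℂ PGen.G) + r⁻¹ ^ 2 • (ι ℂ PGen.C * ι ℂ PGen.C) - 1)

/-- The algebra presented by the relations `GWRel`. -/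
abbrev Presented (r : ℂ) : Type := RingQuot (PRel r)

/-- The class of a generator in the presented algebra. -/
def pgen (r : ℂ) (g : PGen) : Presented r := RingQuot.mkAlgHom ℂ (PRel r) (FreeAlgebra.ι ℂ g)

theorem gwRel_pgen (r : ℂ) : GWRel r (pgen r .E) (pgen r .F) (pgen r .C) (pgen r .G) where
  GE := by
    have := RingQuot.mkAlgHom_rel ℂ (PRel.GE (r := r))
    simp only [map_mul] at this
    exact this
  GF := by
    have := RingQuot.mkAlgHom_rel ℂ (PRel.GF (r := r))
    simp only [map_mul] at this
    exact this
  GC := by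
    have := RingQuot.mkAlgHom_rel ℂ (PRel.GC (r := r))
    simp only [map_mul] at this
    exact this
  CE := by
    have := RingQuot.mkAlgHom_rel ℂ (PRel.CE (r := r))
    simp only [map_mul, map_smul] at this
    exact this
  CF := by
    have := RingQuot.mkAlgHom_rel ℂ (PRel.CF (r := r))
    simp only [map_mul, map_smul] at this
    exact this
  EF := by
    have := RingQuot.mkAlgHom_rel ℂ (PRel.EF (r := r))
    simp only [map_mul, map_smul, map_add, map_sub, map_one] at this
    exact this
  FE := by
    have := RingQuot.mkAlgHom_rel ℂ (PRel.FE (r := r))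
    simp only [map_mul, map_smul, map_add, map_sub, map_one] at this
    exact this

theorem adjoin_pgen (r : ℂ) :
    Algebra.adjoin ℂ {pgen r .E, pgen r .F, pgen r .C, pgen r .G} = ⊤ := by
  have h1 : ({pgen r .E, pgen r .F, pgen r .C, pgen r .G} : Set (Presented r)) =
      RingQuot.mkAlgHom ℂ (PRel r) '' Set.range (FreeAlgebra.ι ℂ) := by
    rw [← Set.range_comp]
    ext x
    constructor
    · rintro (rfl | rfl | rfl | rfl)
      exacts [⟨.E, rfl⟩, ⟨.F, rfl⟩, ⟨.C, rfl⟩, ⟨.G, rfl⟩]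
    · rintro ⟨(_ | _ | _ | _), rfl⟩ <;> simp [pgen]
  rw [h1, ← AlgHom.map_adjoin, FreeAlgebra.adjoin_range_ι, Algebra.map_top,
    AlgHom.range_eq_top]
  exact RingQuot.mkAlgHom_surjective ℂ (PRel r)

variable {A : Type*} [Ring A] [Algebra ℂ A] {r : ℂ} {E F C G : A}

/-- The universal property of the presented algebra. -/
theorem GWRel.exists_lift (h : GWRel r E F C G) : ∃ f : Presented r →ₐ[ℂ] A,
    f (pgen r .E) = E ∧ f (pgen r .F) = F ∧ f (pgen r .C) = C ∧ f (pgen r .G) = G := by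
  let v : PGen → A | .E => E | .F => F | .C => C | .G => G
  have hv : ∀ ⦃x y⦄, PRel r x y → FreeAlgebra.lift ℂ v x = FreeAlgebra.lift ℂ v y := by
    rintro x y (_ | _ | _ | _ | _ | _ | _) <;>
    simp only [map_mul, map_smul, map_add, map_sub, map_one, FreeAlgebra.lift_ι_apply, v]
    exacts [h.GE, h.GF, h.GC, h.CE, h.CF, h.EF, h.FE]
  refine ⟨RingQuot.liftAlgHom ℂ ⟨FreeAlgebra.lift ℂ v, hv⟩, ?_⟩
  simp [pgen, v]

end Presentation

/-! ### The rescaled generators of the coideal subalgebra -/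

section Elements
variable (r : ℂˣ)

/-- `q - q⁻¹`. -/
def qDiff : ℂ := (r : ℂ) ^ 2 - (r : ℂ)⁻¹ ^ 2

/-- The factor q - q⁻¹ in `elE` and `elG` clears all denominators: the structure constants become
signed powers of r. The element `elc` is the inverse of `elC`. -/
def elE : Osp r := qDiff r • (Am r * K r)
def elF : Osp r := Ap r * K r
def elC : Osp r := K r ^ 2 * P r
def elc : Osp r := Kinv r ^ 2 * P r
def elG : Osp r := qDiff r • casimir r

theorem qDiff_eq : qDiff r = qq r - (qq r)⁻¹ := by rw [qDiff, qq, inv_pow]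

variable {r}

theorem qDiff_ne_zero (h : (r : ℂ) ^ 4 ≠ 1) : qDiff r ≠ 0 := by
  have hr := r.ne_zero
  intro h0
  rw [qDiff] at h0
  field_simp at h0
  exact h (by linear_combination h0)

theorem gwInv_el (h : (r : ℂ) ^ 4 ≠ 1) : GWInv (r : ℂ) (elE r) (elF r) (elC r) (elG r) (elc r) := by
  have hr := r.ne_zero
  have h1 : (r : ℂ) ^ 4 - 1 ≠ 0 := sub_ne_zero.2 h
  have h2 : (r : ℂ) ^ 2 - 1 ≠ 0 := fun h0 => h (by linear_combination (r ^ 2 + 1) * h0)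
  have hG : elG r = (-qDiff r) • (Ap r * (Am r * P r)) +
      ((r : ℂ)⁻¹ • (K r * (K r * P r)) - (r : ℂ) • (Kinv r * (Kinv r * P r))) := by
    simp only [elG, casimir, ← qDiff_eq, add_mul, sub_mul, smul_mul_assoc, smul_add, smul_smul,
      mul_inv_cancel₀ (qDiff_ne_zero h), one_smul, neg_mul, smul_neg, neg_smul, pow_two, mul_assoc]
  constructor
  on_goal 1 => constructor
  all_goals
    simp only [hG, elE, elF, elC, elc, qDiff, pow_two (K r), pow_two (Kinv r),
      mul_add, add_mul, mul_sub, sub_mul,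
      mul_assoc, K_Kinv, Kinv_K, P_P, P_K, P_Kinv, P_Ap, P_Am, K_Ap, K_Am, Kinv_Ap, Kinv_Am, Am_Ap,
      push (K_Kinv r), push (Kinv_K r), push (P_P r), push (P_K r), push (P_Kinv r),
      push (P_Ap r), push (P_Am r), push (K_Ap r), push (K_Am r), push (Kinv_Ap r),
      push (Kinv_Am r), push (Am_Ap r), mul_neg, neg_mul, smul_mul_assoc, mul_smul_comm, mul_one,
      one_mul, smul_neg, smul_add, smul_sub, smul_smul]
    try match_scalars <;> (try field_simp) <;> ring

end Elements

/-! ### Weighted shift representations and independence of the normal monomials -/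

section Representation
variable {r : ℂˣ}

/-- The weighted shift operator `f ↦ (i ↦ a i * f (i + d))` on sequences. -/
def shiftOp (a : ℤ → ℂ) (d : ℤ) : Module.End ℂ (ℤ → ℂ) where
  toFun f i := a i * f (i + d)
  map_add' f g := by ext i; simp [mul_add]
  map_smul' c f := by ext i; simp [mul_left_comm]

@[simp] theorem shiftOp_apply (a : ℤ → ℂ) (d : ℤ) (f : ℤ → ℂ) (i : ℤ) :
    shiftOp a d f i = a i * f (i + d) := rfl

theorem shiftOp_pow (a : ℤ → ℂ) (d : ℤ) (n : ℕ) (f : ℤ → ℂ) (i : ℤ) :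
    (shiftOp a d ^ n) f i = (∏ k ∈ Finset.range n, a (i + k * d)) * f (i + n * d) := by
  induction n generalizing i f with
  | zero => simp
  | succ n ih =>
    rw [pow_succ, Module.End.mul_apply, ih, Finset.prod_range_succ, shiftOp_apply]
    push_cast
    rw [add_mul, one_mul, ← add_assoc, mul_assoc]

/-- Weights of `K` in the representation. -/
def wtK (r l : ℂˣ) (i : ℤ) : ℂ := (l : ℂ) * (r : ℂ) ^ i

/-- The eigenvalues of `A₊A₋`. -/
def wtTheta (r l : ℂˣ) (m : ℂ) (i : ℤ) : ℂ :=
  (qDiff r)⁻¹ * ((r : ℂ)⁻¹ * wtK r l i ^ 2 - (r : ℂ) * (wtK r l i)⁻¹ ^ 2) - (-1) ^ i * m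

/-- Values of the generators in the representation. -/
def repGen (r l : ℂˣ) (φ ψ : ℤ → ℂ) : Gen → Module.End ℂ (ℤ → ℂ)
  | .Ap => shiftOp φ (-1)
  | .Am => shiftOp ψ 1
  | .K => shiftOp (wtK r l) 0
  | .Kinv => shiftOp (fun i => (wtK r l i)⁻¹) 0
  | .P => shiftOp (fun i => (-1) ^ i) 0

theorem wtK_ne_zero (l : ℂˣ) (i : ℤ) : wtK r l i ≠ 0 :=
  mul_ne_zero l.ne_zero (zpow_ne_zero _ r.ne_zero)

theorem wtK_add_one (l : ℂˣ) (i : ℤ) : wtK r l (i + 1) = r * wtK r l i := by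
  rw [wtK, wtK, zpow_add_one₀ r.ne_zero]; ring

theorem wtK_sub_one (l : ℂˣ) (i : ℤ) : wtK r l (i + -1) = (r : ℂ)⁻¹ * wtK r l i := by
  rw [wtK, wtK, ← sub_eq_add_neg, zpow_sub_one₀ r.ne_zero]; ring

/-- A₊A₋ acts diagonally with eigenvalues θ(i) = φ(i)ψ(i-1), and A₋A₊ with θ(i+1). The only relation
constraining φ and ψ is thus a formula for θ(i) + θ(i+1), in which the alternating term of `wtTheta`
cancels. The parameter `m` is therefore free; by `rep_el` it is the eigenvalue of the Casimir
operator. -/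
theorem exists_rep (h : (r : ℂ) ^ 4 ≠ 1) (l : ℂˣ) (m : ℂ) (φ ψ : ℤ → ℂ)
    (hφ : ∀ i, φ i * ψ (i - 1) = wtTheta r l m i) :
    ∃ ρ : Osp r →ₐ[ℂ] Module.End ℂ (ℤ → ℂ), ∀ g, ρ (gen r g) = repGen r l φ ψ g := by
  have hr := r.ne_zero
  have h1 : (r : ℂ) ^ 4 - 1 ≠ 0 := sub_ne_zero.2 h
  have h2 : (r : ℂ) ^ 2 - 1 ≠ 0 := fun h0 => h (by linear_combination (r ^ 2 + 1) * h0)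
  have e1 : ∀ i : ℤ, (-1 : ℂ) ^ (i + 1) = -(-1) ^ i := fun i => by
    rw [zpow_add_one₀ (by norm_num)]; ring
  have e2 : ∀ i : ℤ, (-1 : ℂ) ^ (i + -1) = -(-1) ^ i := fun i => by
    rw [← sub_eq_add_neg, zpow_sub_one₀ (by norm_num)]; norm_num
  have hrel : ∀ ⦃x y : FreeAlgebra ℂ Gen⦄, Rel r x y →
      FreeAlgebra.lift ℂ (repGen r l φ ψ) x = FreeAlgebra.lift ℂ (repGen r l φ ψ) y := by
    intro x y hxy
    cases hxy
    all_goals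
      simp only [map_mul, map_add, map_sub, map_smul, map_one, map_zero, map_pow,
        FreeAlgebra.lift_ι_apply, repGen]
      ext f i
      have hk := wtK_ne_zero (r := r) l i
      simp only [Module.End.mul_apply, LinearMap.add_apply, LinearMap.sub_apply,
        LinearMap.smul_apply, Module.End.one_apply, LinearMap.zero_apply, Pi.add_apply,
        Pi.sub_apply, Pi.smul_apply, Pi.zero_apply, smul_eq_mul, shiftOp_apply, pow_two, add_zero,
        wtK_add_one, wtK_sub_one, e1, e2]
    · field_simp
    · field_simp
    · have a1 := hφ i
      have a2 := hφ (i + 1)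
      rw [add_sub_cancel_right] at a2
      rw [neg_add_cancel_right, add_neg_cancel_right]
      rw [← mul_assoc, ← mul_assoc, ← add_mul, ← sub_eq_add_neg, a1, mul_comm (ψ i), a2]
      rw [wtTheta, wtTheta, wtK_add_one, e1, qDiff]
      field_simp
      ring
    · ring
    · ring
    · ring
    · ring
    · field_simp
    · field_simp
    · rw [← mul_assoc, ← mul_zpow]; norm_num
  refine ⟨RingQuot.liftAlgHom ℂ ⟨FreeAlgebra.lift ℂ (repGen r l φ ψ), hrel⟩, fun g => ?_⟩
  have := RingQuot.liftAlgHom_mkAlgHom_apply (S := ℂ) (FreeAlgebra.lift ℂ (repGen r l φ ψ))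
    hrel (FreeAlgebra.ι ℂ g)
  rw [FreeAlgebra.lift_ι_apply] at this
  exact this

end Representation

section Independence
variable {r : ℂˣ}

/-- Values of a representation by weighted shifts on the elements `el*`. -/
theorem rep_el {l : ℂˣ} {m : ℂ} {φ ψ : ℤ → ℂ}
    (hφ : ∀ i, φ i * ψ (i - 1) = wtTheta r l m i)
    {ρ : Osp r →ₐ[ℂ] Module.End ℂ (ℤ → ℂ)} (hρ : ∀ g, ρ (gen r g) = repGen r l φ ψ g) :
    ρ (elE r) = shiftOp (fun i => qDiff r * (ψ i * wtK r l (i + 1))) 1 ∧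
    ρ (elF r) = shiftOp (fun i => φ i * wtK r l (i + -1)) (-1) ∧
    ρ (elC r) = shiftOp (fun i => wtK r l i ^ 2 * (-1) ^ i) 0 ∧
    ρ (elG r) = (qDiff r * m) • 1 := by
  have h1 : ρ (Ap r) = repGen r l φ ψ .Ap := hρ .Ap
  have h2 : ρ (Am r) = repGen r l φ ψ .Am := hρ .Am
  have h3 : ρ (K r) = repGen r l φ ψ .K := hρ .K
  have h4 : ρ (Kinv r) = repGen r l φ ψ .Kinv := hρ .Kinv
  have h5 : ρ (P r) = repGen r l φ ψ .P := hρ .P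
  refine ⟨?_, ?_, ?_, ?_⟩
  · ext f i
    simp [elE, h2, h3, repGen, mul_assoc]
  · ext f i
    simp [elF, h1, h3, repGen, mul_assoc]
  · ext f i
    simp [elC, h3, h5, repGen, mul_assoc, pow_two]
  · ext f i
    simp only [elG, casimir, map_smul, map_mul, map_add, map_neg, map_sub, pow_two, h1, h2, h3,
      h4, h5, repGen, Module.End.mul_apply, LinearMap.add_apply, LinearMap.sub_apply,
      LinearMap.neg_apply, Pi.neg_apply,
      LinearMap.smul_apply, Module.End.one_apply, Pi.add_apply,
      Pi.sub_apply, Pi.smul_apply, smul_eq_mul, shiftOp_apply, add_zero, neg_add_cancel_right]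
    have e : ((-1 : ℂ) ^ i) * (-1) ^ i = 1 := by rw [← mul_zpow]; norm_num
    have a := hφ i
    rw [sub_eq_add_neg] at a
    rw [← mul_assoc (φ i), a, wtTheta, ← qDiff_eq]
    linear_combination (qDiff r * m * f i) * e

/-- The sequence supported at `0`. -/
def delta0 : ℤ → ℂ := Pi.single 0 1

/-- The vector `delta0` is an eigenvector of C with eigenvalue l², and G acts as a scalar. The
exponents of C and G are visible only in the scalar, the exponent of E or F only in the position of
the support. -/
theorem rep_normalMonomial {l : ℂˣ} {m : ℂ} {φ ψ : ℤ → ℂ}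
    (hφ : ∀ i, φ i * ψ (i - 1) = wtTheta r l m i)
    {ρ : Osp r →ₐ[ℂ] Module.End ℂ (ℤ → ℂ)} (hρ : ∀ g, ρ (gen r g) = repGen r l φ ψ g)
    (w : ℤ) (k t : ℕ) :
    ρ (normalMonomial (elE r) (elF r) (elC r) (elG r) (w, k, t)) delta0 =
      (((l : ℂ) ^ 2) ^ k * (qDiff r * m) ^ t) • ρ (zPow (elE r) (elF r) w) delta0 := by
  obtain ⟨-, -, hC, hG⟩ := rep_el hφ hρ
  have hC0 : ρ (elC r) delta0 = ((l : ℂ) ^ 2) • delta0 := by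
    ext i
    rw [hC, shiftOp_apply]
    by_cases hi : i = 0
    · subst hi; simp [wtK]
    · simp [delta0, hi]
  have hCk : (ρ (elC r) ^ k) delta0 = (((l : ℂ) ^ 2) ^ k) • delta0 := by
    induction k with
    | zero => simp
    | succ k ih => rw [pow_succ, Module.End.mul_apply, hC0, map_smul, ih, smul_smul, ← pow_succ']
  rw [normalMonomial, map_mul, map_mul, map_pow, map_pow, hG, smul_pow, one_pow,
    Module.End.mul_apply, Module.End.mul_apply, LinearMap.smul_apply, Module.End.one_apply,
    map_smul, hCk, smul_smul, map_smul, mul_comm]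

theorem rep_zPow_eq_zero {l : ℂˣ} {m : ℂ} {φ ψ : ℤ → ℂ}
    (hφ : ∀ i, φ i * ψ (i - 1) = wtTheta r l m i)
    {ρ : Osp r →ₐ[ℂ] Module.End ℂ (ℤ → ℂ)} (hρ : ∀ g, ρ (gen r g) = repGen r l φ ψ g)
    {w j : ℤ} (hj : j ≠ -w) : ρ (zPow (elE r) (elF r) w) delta0 j = 0 := by
  obtain ⟨hE, hF, -, -⟩ := rep_el hφ hρ
  cases w with
  | ofNat n =>
    rw [zPow, map_pow, hE, shiftOp_pow, delta0, Pi.single_eq_of_ne, mul_zero]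
    intro h0
    exact hj (by simp only [Int.ofNat_eq_natCast]; lia)
  | negSucc n =>
    rw [zPow, map_pow, hF, shiftOp_pow, delta0, Pi.single_eq_of_ne, mul_zero]
    intro h0
    exact hj (by rw [Int.negSucc_eq]; push_cast at h0; lia)

/-- For every weight there is a choice of representation in which that weight is visible. -/
theorem exists_rep_zPow_ne_zero (h : (r : ℂ) ^ 4 ≠ 1) (l : ℂˣ) (m : ℂ) (w : ℤ) :
    ∃ φ ψ : ℤ → ℂ, (∀ i, φ i * ψ (i - 1) = wtTheta r l m i) ∧
      ∃ ρ : Osp r →ₐ[ℂ] Module.End ℂ (ℤ → ℂ), (∀ g, ρ (gen r g) = repGen r l φ ψ g) ∧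
        ρ (zPow (elE r) (elF r) w) delta0 (-w) ≠ 0 := by
  cases w with
  | ofNat n =>
    -- Only the product φ(i)ψ(i-1) is prescribed, and it may vanish. Putting all of it into φ leaves
    -- ψ = 1, so no power of E kills `delta0`; for powers of F the roles are exchanged.
    have hφ : ∀ i, wtTheta r l m i * (fun _ => (1 : ℂ)) (i - 1) = wtTheta r l m i := by simp
    obtain ⟨ρ, hρ⟩ := exists_rep h l m (wtTheta r l m) (fun _ => 1) hφ
    refine ⟨_, _, hφ, ρ, hρ, ?_⟩
    rw [zPow, map_pow, (rep_el (φ := wtTheta r l m) (ψ := fun _ => 1) hφ hρ).1, shiftOp_pow]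
    refine mul_ne_zero (Finset.prod_ne_zero_iff.2 fun k _ => mul_ne_zero (qDiff_ne_zero h)
      (mul_ne_zero one_ne_zero (wtK_ne_zero _ _))) ?_
    simp [delta0]
  | negSucc n =>
    have hφ : ∀ i, (fun _ => (1 : ℂ)) i * (fun i => wtTheta r l m (i + 1)) (i - 1) =
        wtTheta r l m i := by simp
    obtain ⟨ρ, hρ⟩ := exists_rep h l m (fun _ => 1) (fun i => wtTheta r l m (i + 1)) hφ
    refine ⟨_, _, hφ, ρ, hρ, ?_⟩
    rw [zPow, map_pow, (rep_el (φ := fun _ => 1) (ψ := fun i => wtTheta r l m (i + 1)) hφ hρ).2.1, shiftOp_pow]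
    refine mul_ne_zero (Finset.prod_ne_zero_iff.2 fun k _ =>
      mul_ne_zero one_ne_zero (wtK_ne_zero _ _)) ?_
    rw [Int.neg_negSucc]
    simp [delta0]

/-- The character `(l, m) ↦ l ^ (2 k) * m ^ t`. -/
def monomialChar (x : ℕ × ℕ) : ℂˣ × ℂ →* ℂ where
  toFun y := ((y.1 : ℂ) ^ 2) ^ x.1 * y.2 ^ x.2
  map_one' := by simp
  map_mul' y z := by simp [mul_pow]; ring

theorem linearIndependent_monomialChar :
    LinearIndependent ℂ fun x : ℕ × ℕ => (monomialChar x : ℂˣ × ℂ → ℂ) := by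
  refine (linearIndependent_monoidHom (ℂˣ × ℂ) ℂ).comp monomialChar ?_
  rintro ⟨k, t⟩ ⟨k', t'⟩ hx
  have h1 := DFunLike.congr_fun hx (Units.mk0 (2 : ℂ) two_ne_zero, 1)
  have h2 := DFunLike.congr_fun hx (1, 2)
  simp only [monomialChar, MonoidHom.coe_mk, OneHom.coe_mk, Units.val_mk0, one_pow, mul_one,
    Units.val_one, one_mul] at h1 h2
  rw [← pow_mul, ← pow_mul] at h1
  have h1' := Nat.pow_right_injective le_rfl (by exact_mod_cast h1 : 2 ^ (2 * k) = 2 ^ (2 * k'))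
  have h2' := Nat.pow_right_injective le_rfl (by exact_mod_cast h2 : 2 ^ t = 2 ^ t')
  simp only [Prod.mk.injEq]
  exact ⟨by lia, h2'⟩

/-- Applied to `delta0` and evaluated at -w, a vanishing combination retains only the monomials with
first index w. What is left is a relation between the characters (l, m) ↦ l^(2k) m^t for all l and
m, which is trivial by Dedekind's independence of characters. -/
theorem linearIndependent_normalMonomial (h : (r : ℂ) ^ 4 ≠ 1) :
    LinearIndependent ℂ (normalMonomial (elE r) (elF r) (elC r) (elG r)) := by
  rw [linearIndependent_iff]
  intro N hN
  ext ⟨w, k, t⟩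
  -- The indices under test are inserted, so that their coefficient is covered even when it lies
  -- outside the support.
  set S₁ := insert w (N.support.image Prod.fst)
  set S₂ := insert (k, t) (N.support.image Prod.snd)
  have hS : N.support ⊆ S₁ ×ˢ S₂ := fun x hx => Finset.mem_product.2
    ⟨Finset.mem_insert_of_mem (Finset.mem_image_of_mem _ hx),
      Finset.mem_insert_of_mem (Finset.mem_image_of_mem _ hx)⟩
  rw [Finsupp.linearCombination_apply, Finsupp.sum_of_support_subset _ hS _ (by simp)] at hN
  refine linearIndependent_iff'.1 linearIndependent_monomialChar S₂ (fun x => N (w, x)) ?_ (k, t)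
    (Finset.mem_insert_self _ _)
  ext ⟨l, m⟩
  -- Dividing by q - q⁻¹ makes the rescaled Casimir `elG` act exactly by `m`.
  obtain ⟨φ, ψ, hφ, ρ, hρ, hne⟩ := exists_rep_zPow_ne_zero h l (m / qDiff r) w
  have h0 := congrArg (fun x => ρ x delta0 (-w)) hN
  simp only [map_sum, map_smul, map_zero, LinearMap.sum_apply, LinearMap.smul_apply,
    Finset.sum_apply, Pi.smul_apply, LinearMap.zero_apply, Pi.zero_apply] at h0
  rw [Finset.sum_product, Finset.sum_eq_single w] at h0
  · simp only [rep_normalMonomial hφ hρ, Pi.smul_apply, smul_eq_mul,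
      mul_div_cancel₀ m (qDiff_ne_zero h), ← mul_assoc] at h0
    rw [← Finset.sum_mul] at h0
    simpa [monomialChar, mul_assoc] using (mul_eq_zero.1 h0).resolve_right hne
  · intro w' _ hw'
    refine Finset.sum_eq_zero fun x _ => ?_
    rw [rep_normalMonomial hφ hρ, Pi.smul_apply, rep_zPow_eq_zero hφ hρ (by simpa using hw'.symm),
      smul_zero, smul_zero]
  · exact fun hw => absurd (Finset.mem_insert_self _ _) hw

end Independence

/-! ### Presentation of the coideal subalgebra and existence of the coaction -/

section Coaction
variable {r : ℂˣ}

theorem map_normalMonomial {A B : Type*} [Ring A] [Algebra ℂ A] [Ring B] [Algebra ℂ B]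
    (f : A →ₐ[ℂ] B) (E F C G : A) (x : ℤ × ℕ × ℕ) :
    f (normalMonomial E F C G x) = normalMonomial (f E) (f F) (f C) (f G) x := by
  obtain ⟨_ | _, _, _⟩ := x <;> simp [normalMonomial, zPow]

/-- A spanning family of the source is sent to a linearly independent family. -/
theorem presented_injective (h : (r : ℂ) ^ 4 ≠ 1) {f : Presented r →ₐ[ℂ] Osp r}
    (hE : f (pgen r .E) = elE r) (hF : f (pgen r .F) = elF r) (hC : f (pgen r .C) = elC r)
    (hG : f (pgen r .G) = elG r) : Function.Injective f := by
  rw [injective_iff_map_eq_zero]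
  intro x hx
  have hspan := (gwRel_pgen r).span_normalMonomial (adjoin_pgen r)
  have hx' : x ∈ Submodule.span ℂ
      (Set.range (normalMonomial (pgen (r : ℂ) .E) (pgen r .F) (pgen r .C) (pgen r .G))) :=
    hspan ▸ Submodule.mem_top
  obtain ⟨N, rfl⟩ := (Finsupp.mem_span_range_iff_exists_finsupp).1 hx'
  have : N = 0 := by
    refine linearIndependent_iff.1 (linearIndependent_normalMonomial h) N ?_
    rw [Finsupp.linearCombination_apply, ← hx, Finsupp.sum, Finsupp.sum, map_sum]
    refine Finset.sum_congr rfl fun i _ => ?_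
    rw [map_smul, map_normalMonomial, hE, hF, hC, hG]
  simp [this]

theorem gwRel_coideal (h : (r : ℂ) ^ 4 ≠ 1) :
    GWRel (r : ℂ) (qDiff r • genE r) (genF r) (genC r) (qDiff r • genG r) := by
  obtain ⟨GE, GF, GC, CE, CF, EF, FE⟩ := (gwInv_el h).toGWRel
  exact ⟨Subtype.ext GE, Subtype.ext GF, Subtype.ext GC, Subtype.ext CE, Subtype.ext CF,
    Subtype.ext EF, Subtype.ext FE⟩

/-- Some morphism with the prescribed values must be exhibited. The presented algebra is isomorphic
to the coideal subalgebra, and `GWRel.tau` gives a morphism out of the former. -/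
theorem isCoaction_tau (h : (r : ℂ) ^ 4 ≠ 1) : IsCoaction r (tau r) := by
  refine Classical.epsilon_spec (p := IsCoaction r) ?_
  have hd := qDiff_ne_zero h
  obtain ⟨f, fE, fF, fC, fG⟩ := (gwRel_coideal h).exists_lift
  have hinj : Function.Injective f := by
    refine Function.Injective.of_comp (f := (coidealAlg r).val) ?_
    refine presented_injective (f := (coidealAlg r).val.comp f) h ?_ ?_ ?_ ?_ <;>
    simp only [AlgHom.comp_apply, fE, fF, fC, fG] <;> rfl
  have hsurj : Function.Surjective f := by
    have hle : coidealAlg r ≤ ((coidealAlg r).val.comp f).range := by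
      refine Algebra.adjoin_le ?_
      rintro x (rfl | rfl | rfl | rfl)
      · refine ⟨(qDiff r)⁻¹ • pgen r .E, ?_⟩
        change (coidealAlg r).val (f _) = _
        rw [map_smul, fE, smul_smul, inv_mul_cancel₀ hd, one_smul]; rfl
      · exact ⟨pgen r .F, congrArg Subtype.val fF⟩
      · exact ⟨pgen r .C, congrArg Subtype.val fC⟩
      · refine ⟨(qDiff r)⁻¹ • pgen r .G, ?_⟩
        change (coidealAlg r).val (f _) = _
        rw [map_smul, fG, smul_smul, inv_mul_cancel₀ hd, one_smul]; rfl
    intro x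
    obtain ⟨y, hy⟩ := hle x.2
    exact ⟨y, Subtype.ext hy⟩
  let e := AlgEquiv.ofBijective f ⟨hinj, hsurj⟩
  have esymm : ∀ x, e.symm (f x) = x := fun x => e.symm_apply_apply x
  obtain ⟨g, gE, gF, gC, gG⟩ := (GWRel.tau r.ne_zero (gwInv_el h) (gwRel_coideal h)).exists_lift
  have cancel {M : Type} [AddCommGroup M] [Module ℂ M] {x y : M}
      (hxy : qDiff r • x = qDiff r • y) : x = y := by
    simpa [smul_smul, hd] using congrArg ((qDiff r)⁻¹ • ·) hxy
  have hr := r.ne_zero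
  have hFF : elF r * elF r * elc r = (r : ℂ) • (Ap r ^ 2 * P r) := by
    simp only [elF, elc, pow_two, mul_assoc, K_Kinv, P_P, P_K, P_Kinv, P_Ap, K_Ap, Kinv_Ap,
      push (K_Kinv r), push (K_Ap r), smul_mul_assoc, mul_smul_comm, mul_one, one_mul]
  have hFc : elF r * elc r = Ap r * Kinv r * P r := by
    simp only [elF, elc, pow_two, mul_assoc, push (K_Kinv r), one_mul]
  refine ⟨g.comp e.symm.toAlgHom, ?_, ?_, ?_, ?_⟩
  · refine cancel ?_
    rw [← map_smul, ← fE]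
    change g (e.symm (f _)) = _
    rw [esymm, gE, TensorProduct.tmul_smul]; rfl
  · rw [← fF]
    change g (e.symm (f _)) = _
    rw [esymm, gF, hFF, hFc, fF, ← qDiff_eq]
    simp only [TensorProduct.tmul_smul, ← TensorProduct.smul_tmul', smul_smul, elc]
    match_scalars <;> field_simp
  · rw [← fC]
    change g (e.symm (f _)) = _
    rw [esymm, gC, fC, ← qDiff_eq, TensorProduct.tmul_smul]; rfl
  · refine cancel ?_
    rw [← map_smul, ← fG]
    change g (e.symm (f _)) = _
    rw [esymm, gG, TensorProduct.tmul_smul]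

end Coaction

/-! ### Carrying all stages into one fixed tensor power -/

section Padding
variable (r : ℂˣ)

/-- The inclusion of a single slot into `osp^{⊗n}`. -/
def slot {n : ℕ} (i : Fin n) : Osp r →ₐ[ℂ] Tens r n :=
  PiTensorProduct.singleAlgHom (R := ℂ) (A := fun _ : Fin n => Osp r) i

/-- `padRight` as a linear map. -/
def padLinear {n k : ℕ} (h : k ≤ n) : Tens r k →ₗ[ℂ] Tens r n :=
  (TensorPower.cast ℂ (Osp r) (Nat.add_sub_of_le h)).toLinearMap ∘ₗ
    (TensorPower.mulEquiv (R := ℂ) (M := Osp r) (n := k) (m := n - k)).toLinearMap ∘ₗ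
      (TensorProduct.mk ℂ (Tens r k) (Tens r (n - k))).flip 1

theorem padRight_eq {n k : ℕ} (h : k ≤ n) (x : Tens r k) : padRight r n k x = padLinear r h x := by
  rw [padRight, dif_pos h]; rfl

theorem padLinear_tprod {n k : ℕ} (h : k ≤ n) (a : Fin k → Osp r) :
    padLinear r h (PiTensorProduct.tprod ℂ a) =
      PiTensorProduct.tprod ℂ fun i : Fin n => if hi : (i : ℕ) < k then a ⟨i, hi⟩ else 1 := by
  change TensorPower.cast ℂ (Osp r) (Nat.add_sub_of_le h)
    (TensorPower.mulEquiv (PiTensorProduct.tprod ℂ a ⊗ₜ[ℂ]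
      PiTensorProduct.tprod ℂ (1 : Fin (n - k) → Osp r))) = _
  rw [← TensorPower.gMul_def, TensorPower.tprod_mul_tprod, TensorPower.cast_tprod]
  congr 1
  funext i
  rw [Function.comp_apply, Fin.append, Fin.addCases]
  simp only [Fin.val_cast, Pi.one_apply]
  split_ifs with hi
  · rfl
  · simp

theorem padLinear_one {n k : ℕ} (h : k ≤ n) : padLinear r h 1 = 1 := by
  change padLinear r h (PiTensorProduct.tprod ℂ 1) = PiTensorProduct.tprod ℂ 1
  rw [padLinear_tprod]
  congr 1
  funext i
  simp

/-- Appending a slot becomes multiplication by an element of that slot, so stages of varying length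
can be compared inside the single algebra `Tens r n`. -/
theorem padLinear_snoc {n k : ℕ} (h : k + 1 ≤ n) (t : Tens r k) (u : Osp r) :
    padLinear r h (snoc r k (t ⊗ₜ u)) =
      padLinear r (Nat.le_of_succ_le h) t * slot r ⟨k, h⟩ u := by
  have key : padLinear r h ∘ₗ (snoc r k).toLinearMap ∘ₗ (TensorProduct.mk ℂ (Tens r k) _).flip u =
      (LinearMap.mulRight ℂ (slot r (⟨k, h⟩ : Fin n) u)) ∘ₗ
        padLinear r (Nat.le_of_succ_le h) := by
    refine PiTensorProduct.ext (MultilinearMap.ext fun a => ?_)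
    change padLinear r h (snoc r k (PiTensorProduct.tprod ℂ a ⊗ₜ u)) =
      padLinear r (Nat.le_of_succ_le h) (PiTensorProduct.tprod ℂ a) *
        PiTensorProduct.tprod ℂ (Pi.mulSingle (M := fun _ : Fin n => Osp r) ⟨k, h⟩ u)
    rw [snoc_tprod, padLinear_tprod, padLinear_tprod, PiTensorProduct.tprod_mul_tprod]
    congr 1
    funext i
    rw [Pi.mul_apply]
    rcases lt_trichotomy (i : ℕ) k with hi | hi | hi
    · have hne : i ≠ ⟨k, h⟩ := fun h0 => by rw [h0] at hi; exact lt_irrefl _ hi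
      rw [dif_pos (by lia), dif_pos hi, Pi.mulSingle_eq_of_ne hne, mul_one, Fin.snoc, dif_pos hi]
      rfl
    · obtain rfl : i = ⟨k, h⟩ := Fin.ext hi
      simp [Fin.snoc]
    · have hne : i ≠ ⟨k, h⟩ := fun h0 => by rw [h0] at hi; exact lt_irrefl _ hi
      rw [dif_neg (by lia), dif_neg (by lia), Pi.mulSingle_eq_of_ne hne, mul_one]
  exact LinearMap.congr_fun key t

theorem slot_commute {n : ℕ} {i j : Fin n} (hij : i ≠ j) (u v : Osp r) :
    Commute (slot r i u) (slot r j v) :=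
  Commute.tprod (Pi.mulSingle_commute (f := fun _ : Fin n => Osp r) hij u v)

end Padding

section Stages
variable (r : ℂˣ)

/-- Pad all slots but the last one. -/
def padStage {n k : ℕ} (h : k ≤ n) : Tens r k ⊗[ℂ] coidealAlg r →ₗ[ℂ] Tens r n ⊗[ℂ] coidealAlg r :=
  (padLinear r h).rTensor _

/-- Apply `φ` to the last slot, and put its left leg into slot `i` of `osp^{⊗n}`. -/
def onSlot {n : ℕ} (φ : coidealAlg r →ₐ[ℂ] Osp r ⊗[ℂ] coidealAlg r) (i : Fin n) :
    Tens r n ⊗[ℂ] coidealAlg r →ₗ[ℂ] Tens r n ⊗[ℂ] coidealAlg r :=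
  TensorProduct.lift ((LinearMap.mul ℂ (Tens r n ⊗[ℂ] coidealAlg r)).compl₁₂
    (Algebra.TensorProduct.includeLeft (S := ℂ)).toLinearMap
    ((Algebra.TensorProduct.map (slot r i) (AlgHom.id ℂ _)).toLinearMap ∘ₗ φ.toLinearMap))

theorem onSlot_tmul {n : ℕ} (φ : coidealAlg r →ₐ[ℂ] Osp r ⊗[ℂ] coidealAlg r) (i : Fin n)
    (t : Tens r n) (y : coidealAlg r) :
    onSlot r φ i (t ⊗ₜ y) =
      (t ⊗ₜ 1) * Algebra.TensorProduct.map (slot r i) (AlgHom.id ℂ (coidealAlg r)) (φ y) := rfl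

set_option synthInstance.maxHeartbeats 400000 in
theorem padStage_onLast {n k : ℕ} (h : k + 1 ≤ n)
    (φ : coidealAlg r →ₐ[ℂ] Osp r ⊗[ℂ] coidealAlg r) (x : Tens r k ⊗[ℂ] coidealAlg r) :
    padStage r h (onLast r φ k x) =
      onSlot r φ ⟨k, h⟩ (padStage r (Nat.le_of_succ_le h) x) := by
  induction x with
  | zero => simp only [map_zero]
  | add x y hx hy => simp only [map_add, hx, hy]
  | tmul t y =>
    simp only [onLast, padStage, LinearMap.comp_apply, LinearMap.lTensor_tmul,
      LinearMap.rTensor_tmul, onSlot_tmul, AlgHom.toLinearMap_apply, LinearEquiv.coe_coe]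
    induction φ y with
    | zero => simp only [TensorProduct.tmul_zero, map_zero, mul_zero]
    | add a b ha hb => simp only [TensorProduct.tmul_add, map_add, mul_add, ha, hb]
    | tmul u v =>
      rw [TensorProduct.assoc_symm_tmul, LinearMap.rTensor_tmul, LinearMap.rTensor_tmul,
        Algebra.TensorProduct.map_tmul, Algebra.TensorProduct.tmul_mul_tmul, one_mul,
        LinearEquiv.coe_coe, padLinear_snoc, AlgHom.id_apply]

/-- Put the last slot into slot `i` of `osp^{⊗n}`. -/
def lastSlot {n : ℕ} (i : Fin n) : Tens r n ⊗[ℂ] coidealAlg r →ₗ[ℂ] Tens r n :=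
  TensorProduct.lift ((LinearMap.mul ℂ (Tens r n)).compl₁₂ LinearMap.id
    ((slot r i).toLinearMap ∘ₗ (coidealAlg r).val.toLinearMap))

@[simp] theorem lastSlot_tmul {n : ℕ} (i : Fin n) (t : Tens r n) (y : coidealAlg r) :
    lastSlot r i (t ⊗ₜ y) = t * slot r i y := rfl

theorem padRight_stageVal {n k : ℕ} (h : k + 1 ≤ n) (x : Tens r k ⊗[ℂ] coidealAlg r) :
    padRight r n (k + 1) (stageVal r ⟨k, x⟩) =
      lastSlot r ⟨k, h⟩ (padStage r (Nat.le_of_succ_le h) x) := by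
  rw [padRight_eq r h]
  induction x with
  | zero => simp only [stageVal, map_zero]
  | add x y hx hy =>
    simp only [stageVal, map_add] at hx hy ⊢
    rw [hx, hy]
  | tmul t y =>
    rw [stageVal, LinearMap.lTensor_tmul, padLinear_snoc, padStage, LinearMap.rTensor_tmul,
      lastSlot_tmul]
    rfl

end Stages

/-! ### Coassociativity and iterated coproducts -/

section Coassociativity
variable (r : ℂˣ)

theorem comul_coassoc (x : Osp r) :
    Algebra.TensorProduct.assoc ℂ ℂ ℂ (Osp r) (Osp r) (Osp r)
        (Algebra.TensorProduct.map (comul r) (AlgHom.id ℂ _) (comul r x)) =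
      Algebra.TensorProduct.map (AlgHom.id ℂ _) (comul r) (comul r x) := by
  have key : ((Algebra.TensorProduct.assoc ℂ ℂ ℂ (Osp r) (Osp r) (Osp r)).toAlgHom.comp
        (Algebra.TensorProduct.map (comul r) (AlgHom.id ℂ _))).comp (comul r) =
      (Algebra.TensorProduct.map (AlgHom.id ℂ _) (comul r)).comp (comul r) := by
    refine RingQuot.ringQuot_ext' ℂ _ _ (FreeAlgebra.hom_ext ?_)
    funext g
    change Algebra.TensorProduct.assoc ℂ ℂ ℂ (Osp r) (Osp r) (Osp r)
        (Algebra.TensorProduct.map (comul r) (AlgHom.id ℂ _) (comul r (gen r g))) =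
      Algebra.TensorProduct.map (AlgHom.id ℂ _) (comul r) (comul r (gen r g))
    have hAp : comul r (Ap r) = comulGen r .Ap := comul_gen r .Ap
    have hAm : comul r (Am r) = comulGen r .Am := comul_gen r .Am
    have hK : comul r (K r) = comulGen r .K := comul_gen r .K
    have hKi : comul r (Kinv r) = comulGen r .Kinv := comul_gen r .Kinv
    have hP : comul r (P r) = comulGen r .P := comul_gen r .P
    rw [comul_gen]
    cases g <;>
    simp [comulGen, hAp, hAm, hK, hKi, hP, TensorProduct.add_tmul, TensorProduct.tmul_add,
      add_assoc]
  exact DFunLike.congr_fun key x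

/-- Both sides are compared after including the last leg into `Osp r`, which is injective by
flatness over ℂ; there the claim is `comul_coassoc`. -/
theorem comulI_coassoc (x : coidealAlg r) :
    Algebra.TensorProduct.assoc ℂ ℂ ℂ (Osp r) (Osp r) (coidealAlg r)
        (Algebra.TensorProduct.map (comul r) (AlgHom.id ℂ _) (comulI r x)) =
      Algebra.TensorProduct.map (AlgHom.id ℂ _) (comulI r) (comulI r x) := by
  have hinj : Function.Injective
      (Algebra.TensorProduct.map (AlgHom.id ℂ (Osp r)) (inclAlg r)) :=
    Module.Flat.lTensor_preserves_injective_linearMap (M := Osp r)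
      (inclAlg r).toLinearMap (inclAlg_injective r)
  apply hinj
  have h1 : ∀ z : Osp r ⊗[ℂ] coidealAlg r,
      Algebra.TensorProduct.map (AlgHom.id ℂ (Osp r)) (inclAlg r)
        (Algebra.TensorProduct.assoc ℂ ℂ ℂ (Osp r) (Osp r) (coidealAlg r)
          (Algebra.TensorProduct.map (comul r) (AlgHom.id ℂ _) z)) =
      Algebra.TensorProduct.assoc ℂ ℂ ℂ (Osp r) (Osp r) (Osp r)
        (Algebra.TensorProduct.map (comul r) (AlgHom.id ℂ _) (inclAlg r z)) := by
    intro z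
    induction z with
    | zero => simp only [map_zero]
    | add a b ha hb => simp only [map_add, ha, hb]
    | tmul a y =>
      simp only [inclAlg, Algebra.TensorProduct.map_tmul, AlgHom.id_apply]
      induction comul r a with
      | zero => simp only [TensorProduct.zero_tmul, map_zero]
      | add a b ha hb => simp only [TensorProduct.add_tmul, map_add, ha, hb]
      | tmul a b => rfl
  have h2 : ∀ z : Osp r ⊗[ℂ] coidealAlg r,
      Algebra.TensorProduct.map (AlgHom.id ℂ (Osp r)) (inclAlg r)
        (Algebra.TensorProduct.map (AlgHom.id ℂ _) (comulI r) z) =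
      Algebra.TensorProduct.map (AlgHom.id ℂ (Osp r)) (comul r) (inclAlg r z) := by
    intro z
    induction z with
    | zero => simp only [map_zero]
    | add a b ha hb => simp only [map_add, ha, hb]
    | tmul a y =>
      simp only [Algebra.TensorProduct.map_tmul, AlgHom.id_apply, inclAlg_comulI]
      simp only [inclAlg, Algebra.TensorProduct.map_tmul, AlgHom.id_apply, Subalgebra.coe_val]
  rw [h1, h2, inclAlg_comulI, comul_coassoc]

end Coassociativity

section Iteration
variable (r : ℂˣ)

/-- The iterated coproducts of the Casimir operator. -/
def comulIter : (k : ℕ) → Tens r k ⊗[ℂ] coidealAlg r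
  | 0 => 1 ⊗ₜ genG r
  | k + 1 => onLast r (comulI r) k (comulIter k)

theorem lastSlot_map {n : ℕ} {i : Fin n} (D : Osp r →ₐ[ℂ] Tens r n)
    (hD : ∀ u v, Commute (D u) (slot r i v)) (z : Osp r ⊗[ℂ] coidealAlg r) :
    lastSlot r i (Algebra.TensorProduct.map D (AlgHom.id ℂ _) z) =
      Algebra.TensorProduct.lift D (slot r i) hD (inclAlg r z) := by
  induction z with
  | zero => simp only [map_zero]
  | add a b ha hb => simp only [map_add, ha, hb]
  | tmul a y =>
    simp only [inclAlg, Algebra.TensorProduct.map_tmul, AlgHom.id_apply, lastSlot_tmul,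
      Algebra.TensorProduct.lift_tmul, Subalgebra.coe_val]

/-- Here `D` is the iterated coproduct into slots 0, …, k. The stages apply Δ repeatedly to the last
leg; coassociativity moves these coproducts to the first leg, where they assemble into `D`. Hence
the first k + 1 slots behave as one copy of `Osp r`. -/
theorem exists_iterated_comul {n : ℕ} (k : ℕ) (hk : k + 1 ≤ n) :
    ∃ D : Osp r →ₐ[ℂ] Tens r n, (∀ i : Fin n, k + 1 ≤ i → ∀ u v, Commute (D u) (slot r i v)) ∧
      padStage r hk (comulIter r (k + 1)) =
        Algebra.TensorProduct.map D (AlgHom.id ℂ _) (comulI r (genG r)) ∧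
      lastSlot r ⟨k, hk⟩ (padStage r (Nat.le_of_succ_le hk) (comulIter r k)) = D (casimir r) := by
  induction k with
  | zero =>
    have h0 : padStage r (Nat.zero_le n) (comulIter r 0) = 1 ⊗ₜ genG r := by
      rw [comulIter, padStage, LinearMap.rTensor_tmul, padLinear_one]
    refine ⟨slot r ⟨0, hk⟩, fun i hi => slot_commute r ?_, ?_, ?_⟩
    · rintro rfl
      exact absurd hi (by simp)
    · rw [comulIter, padStage_onLast, h0, onSlot_tmul, ← Algebra.TensorProduct.one_def, one_mul]
    · rw [h0, lastSlot_tmul, one_mul]; rfl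
  | succ k ih =>
    obtain ⟨D, hD, hstage, hval⟩ := ih (Nat.le_of_succ_le hk)
    have hc : ∀ u v, Commute (D u) (slot r (⟨k + 1, hk⟩ : Fin n) v) := hD ⟨k + 1, hk⟩ le_rfl
    refine ⟨(Algebra.TensorProduct.lift D (slot r ⟨k + 1, hk⟩) hc).comp (comul r), ?_, ?_, ?_⟩
    · intro i hi u v
      rw [AlgHom.comp_apply]
      induction comul r u with
      | zero => rw [map_zero]; exact Commute.zero_left _
      | add a b ha hb => rw [map_add]; exact ha.add_left hb
      | tmul a b =>
        rw [Algebra.TensorProduct.lift_tmul]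
        refine (hD i (by lia) a v).mul_left (slot_commute r ?_ b v)
        rintro rfl
        exact absurd hi (by simp)
    · rw [comulIter, padStage_onLast, hstage]
      have hM : ∀ (u : Osp r) (z : Osp r ⊗[ℂ] coidealAlg r),
          Commute ((Algebra.TensorProduct.includeLeft (S := ℂ) (B := coidealAlg r)).comp D u)
            (Algebra.TensorProduct.map (slot r (⟨k + 1, hk⟩ : Fin n)) (AlgHom.id ℂ _) z) := by
        intro u z
        induction z with
        | zero => rw [map_zero]; exact Commute.zero_right _
        | add a b ha hb => rw [map_add]; exact ha.add_right hb
        | tmul a y =>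
          rw [commute_iff_eq]
          simp only [AlgHom.comp_apply, Algebra.TensorProduct.includeLeft_apply,
            Algebra.TensorProduct.map_tmul, Algebra.TensorProduct.tmul_mul_tmul, one_mul, mul_one,
            (hc u a).eq]
      -- `M` places the first leg through `D`, the second in slot k + 1, and keeps the third.
      -- Extending the old stage and applying the new `D` are both `M` after a double coproduct,
      -- bracketed in the two ways.
      let M := Algebra.TensorProduct.lift _ _ hM
      have h1 : ∀ z : Osp r ⊗[ℂ] coidealAlg r,
          onSlot r (comulI r) ⟨k + 1, hk⟩ (Algebra.TensorProduct.map D (AlgHom.id ℂ _) z) =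
            M (Algebra.TensorProduct.map (AlgHom.id ℂ _) (comulI r) z) := by
        intro z
        induction z with
        | zero => simp only [map_zero]
        | add a b ha hb => simp only [map_add, ha, hb]
        | tmul a y => rfl
      have h2 : ∀ z : Osp r ⊗[ℂ] coidealAlg r,
          Algebra.TensorProduct.map
            ((Algebra.TensorProduct.lift D (slot r ⟨k + 1, hk⟩) hc).comp (comul r))
            (AlgHom.id ℂ _) z =
          M (Algebra.TensorProduct.assoc ℂ ℂ ℂ (Osp r) (Osp r) (coidealAlg r)
            (Algebra.TensorProduct.map (comul r) (AlgHom.id ℂ _) z)) := by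
        intro z
        induction z with
        | zero => simp only [map_zero]
        | add a b ha hb => simp only [map_add, ha, hb]
        | tmul a y =>
          simp only [Algebra.TensorProduct.map_tmul, AlgHom.id_apply, AlgHom.comp_apply]
          induction comul r a with
          | zero => simp only [TensorProduct.zero_tmul, map_zero]
          | add a b ha hb => simp only [TensorProduct.add_tmul, map_add, ha, hb]
          | tmul a b =>
            simp only [Algebra.TensorProduct.assoc_tmul, M, Algebra.TensorProduct.lift_tmul,
              AlgHom.comp_apply, Algebra.TensorProduct.includeLeft_apply,
              Algebra.TensorProduct.map_tmul, AlgHom.id_apply,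
              Algebra.TensorProduct.tmul_mul_tmul, one_mul]
      rw [h1, h2, comulI_coassoc]
    · rw [hstage, lastSlot_map r D hc, inclAlg_comulI, AlgHom.comp_apply]; rfl

end Iteration

/-! ### The stages of the seven index sets -/

section Operators
variable (r : ℂˣ)

theorem Gam_eq {n : ℕ} {A : Finset ℕ} {lo hi : ℕ} (hlo : lo ∈ A) (hhi : hi ∈ A)
    (h : ∀ x ∈ A, lo ≤ x ∧ x ≤ hi) :
    Gam r n A = padRight r n ((stage r A lo hi).1 + 1) (stageVal r (stage r A lo hi)) := by
  have hne : A.Nonempty := ⟨lo, hlo⟩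
  have h1 : A.min' hne = lo :=
    le_antisymm (A.min'_le _ hlo) ((h _ (A.min'_mem hne)).1)
  have h2 : A.max' hne = hi :=
    le_antisymm ((h _ (A.max'_mem hne)).2) (A.le_max' _ hhi)
  rw [Gam, dif_pos hne, h1, h2]

theorem foldl_extend_eq {A : Finset ℕ} (k : ℕ) (h : ∀ i, 1 ≤ i → i ≤ k + 1 → i ∈ A) :
    (List.range' 2 k).foldl (fun s i => extend r (i - 1 ∈ A) (i ∈ A) s)
      ⟨0, (1 : Tens r 0) ⊗ₜ[ℂ] genG r⟩ = ⟨k, comulIter r k⟩ := by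
  induction k with
  | zero => rfl
  | succ k ih =>
    rw [List.range'_1_concat, List.foldl_append, ih fun i h1 h2 => h i h1 (by lia)]
    simp only [List.foldl_cons, List.foldl_nil, extend]
    rw [if_pos (h _ (by lia) (by lia)), if_pos (h _ (by lia) (by lia))]
    rfl

theorem Gam_Icc {n k : ℕ} (hk : k + 1 ≤ n) : Gam r n (Finset.Icc 1 (k + 1)) =
    lastSlot r ⟨k, hk⟩ (padStage r (Nat.le_of_succ_le hk) (comulIter r k)) := by
  rw [Gam_eq r (lo := 1) (hi := k + 1) (by simp) (by simp) (by simp),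
    show stage r (Finset.Icc 1 (k + 1)) 1 (k + 1) = ⟨k, comulIter r k⟩ from
      foldl_extend_eq r k fun i h1 h2 => Finset.mem_Icc.2 ⟨h1, h2⟩, padRight_stageVal]

theorem padStage_one {n k : ℕ} (hk : k ≤ n) :
    padStage r hk ((1 : Tens r k) ⊗ₜ[ℂ] genG r) = 1 ⊗ₜ genG r := by
  rw [padStage, LinearMap.rTensor_tmul, padLinear_one]

theorem Gam_singleton {n k : ℕ} (hk : k + 1 ≤ n) :
    Gam r n {k + 1} = slot r ⟨k, hk⟩ (casimir r) := by
  rw [Gam_eq r (lo := k + 1) (hi := k + 1) (by simp) (by simp) (by simp)]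
  rw [show stage r {k + 1} (k + 1) (k + 1) = ⟨k, 1 ⊗ₜ genG r⟩ by simp [stage],
    padRight_stageVal r hk, padStage_one, lastSlot_tmul, one_mul]
  rfl

theorem Gam_pair {n k : ℕ} (hk : k + 2 ≤ n) :
    Gam r n {k + 1, k + 2} =
      lastSlot r ⟨k + 1, hk⟩ (onSlot r (comulI r) ⟨k, Nat.le_of_succ_le hk⟩ (1 ⊗ₜ genG r)) := by
  rw [Gam_eq r (lo := k + 1) (hi := k + 2) (by simp) (by simp) (by simp)]
  rw [show stage r {k + 1, k + 2} (k + 1) (k + 2) =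
    ⟨k + 1, onLast r (comulI r) k (1 ⊗ₜ genG r)⟩ by simp [stage, extend],
    padRight_stageVal r hk, padStage_onLast, padStage_one]

theorem Gam_skip {n k : ℕ} (hk : k + 3 ≤ n) :
    Gam r n (Finset.Icc 1 (k + 1) ∪ {k + 3}) =
      lastSlot r ⟨k + 2, hk⟩ (onSlot r (tau r) ⟨k + 1, Nat.le_of_succ_le hk⟩
        (padStage r (Nat.le_of_succ_le (Nat.le_of_succ_le hk)) (comulIter r (k + 1)))) := by
  rw [Gam_eq r (lo := 1) (hi := k + 3) (by simp) (by simp) (by simp; lia)]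
  have hst : stage r (Finset.Icc 1 (k + 1) ∪ {k + 3}) 1 (k + 3) =
      ⟨k + 2, onLast r (tau r) (k + 1) (comulIter r (k + 1))⟩ := by
    rw [stage, show k + 3 - 1 = k + 1 + 1 from rfl, List.range'_1_concat, List.range'_1_concat,
      List.foldl_append, List.foldl_append]
    change List.foldl _ (List.foldl _ (List.foldl _ (⟨0, (1 : Tens r 0) ⊗ₜ[ℂ] genG r⟩ : Stage r) _)
      _) _ = _
    rw [foldl_extend_eq r k fun i h1 h2 => by simp [h1, h2]]
    simp only [List.foldl_cons, List.foldl_nil, extend]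
    -- The gap has length one: the index k + 2 triggers Δ followed by τ, and the index k + 3
    -- triggers the identity.
    have m1 : 1 + 1 + k - 1 ∈ Finset.Icc 1 (k + 1) ∪ {k + 3} := by
      rw [Finset.mem_union, Finset.mem_Icc]; left; lia
    have m2 : 1 + 1 + k ∉ Finset.Icc 1 (k + 1) ∪ {k + 3} := by
      rw [Finset.mem_union, Finset.mem_Icc, Finset.mem_singleton]; lia
    have m3 : 1 + 1 + (k + 1) - 1 ∉ Finset.Icc 1 (k + 1) ∪ {k + 3} := by
      rw [Finset.mem_union, Finset.mem_Icc, Finset.mem_singleton]; lia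
    have m4 : 1 + 1 + (k + 1) ∈ Finset.Icc 1 (k + 1) ∪ {k + 3} := by
      rw [Finset.mem_union, Finset.mem_singleton]; right; lia
    rw [if_pos m1, if_neg m2, if_neg m3, if_pos m4]
    rfl
  rw [hst, padRight_stageVal r hk, padStage_onLast]

end Operators

/-! ### Coproduct and coaction on the rescaled generators -/

section Values
variable {r : ℂˣ}

theorem elF_mul_elc : elF r * elc r = Ap r * Kinv r * P r := by
  simp only [elF, elc, pow_two, mul_assoc, push (K_Kinv r), one_mul]

theorem elE_mul_elc : elE r * elc r = qDiff r • (Am r * Kinv r * P r) := by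
  simp only [elE, elc, pow_two, mul_assoc, push (K_Kinv r), one_mul, smul_mul_assoc]

theorem comul_elC : comul r (elC r) = elC r ⊗ₜ elC r := by
  have hK : comul r (K r) = comulGen r .K := comul_gen r .K
  have hP : comul r (P r) = comulGen r .P := comul_gen r .P
  simp [elC, hK, hP, comulGen, pow_two]

theorem comul_elE : comul r (elE r) = elE r ⊗ₜ elC r + 1 ⊗ₜ elE r := by
  have hK : comul r (K r) = comulGen r .K := comul_gen r .K
  have hA : comul r (Am r) = comulGen r .Am := comul_gen r .Am
  simp [elE, elC, hK, hA, comulGen, pow_two, add_mul, mul_assoc, P_K, Kinv_K,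
    TensorProduct.smul_tmul']

theorem comul_elF : comul r (elF r) = elF r ⊗ₜ elC r + 1 ⊗ₜ elF r := by
  have hK : comul r (K r) = comulGen r .K := comul_gen r .K
  have hA : comul r (Ap r) = comulGen r .Ap := comul_gen r .Ap
  simp [elF, elC, hK, hA, comulGen, pow_two, add_mul, mul_assoc, P_K, Kinv_K]

/-- `comul_casimir` is pulled back along the injective `inclAlg`. The scaling turns `qHalf` into r -
r⁻¹ and produces the coefficients of `cas12`. -/
theorem smul_comulI_genG (h : (r : ℂ) ^ 4 ≠ 1) : qDiff r • comulI r (genG r) =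
    (-(r : ℂ)) • ((elE r * elc r) ⊗ₜ genF r) + (r : ℂ)⁻¹ • ((elF r * elc r) ⊗ₜ (qDiff r • genE r))
      + ((r : ℂ) - (r : ℂ)⁻¹) • (elc r ⊗ₜ genC r) + elG r ⊗ₜ genC r
      + elc r ⊗ₜ (qDiff r • genG r) := by
  have hc : comulI r (genG r) = _ :=
    inclAlg_injective r ((inclAlg_comulI r (genG r)).trans (comul_casimir r))
  have hq : qDiff r * qHalf r = (r : ℂ) - (r : ℂ)⁻¹ := by
    rw [qHalf, ← qDiff_eq, mul_div_cancel₀ _ (qDiff_ne_zero h)]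
  rw [hc, elE_mul_elc, elF_mul_elc]
  simp only [smul_add, smul_smul, hq, TensorProduct.tmul_smul, ← TensorProduct.smul_tmul', elG,
    elc, mul_comm (qDiff r)]

theorem comul_elG (h : (r : ℂ) ^ 4 ≠ 1) : comul r (elG r) =
    (-(r : ℂ)) • ((elE r * elc r) ⊗ₜ elF r) + (r : ℂ)⁻¹ • ((elF r * elc r) ⊗ₜ elE r)
      + ((r : ℂ) - (r : ℂ)⁻¹) • (elc r ⊗ₜ elC r) + elG r ⊗ₜ elC r + elc r ⊗ₜ elG r := by
  have := congrArg (inclAlg r) (smul_comulI_genG h)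
  rw [map_smul, inclAlg_comulI, ← map_smul] at this
  refine this.trans ?_
  simp only [map_add, map_smul, inclAlg, Algebra.TensorProduct.map_tmul, AlgHom.id_apply]
  rfl

theorem tau_genF (h : (r : ℂ) ^ 4 ≠ 1) : inclAlg r (tau r (genF r)) =
    elc r ⊗ₜ elF r + (r : ℂ)⁻¹ ^ 2 • ((elF r * elF r * elc r) ⊗ₜ elE r)
      + (1 - (r : ℂ)⁻¹ ^ 2) • ((elF r * elc r) ⊗ₜ elC r)
      + (r : ℂ)⁻¹ • ((elF r * elc r) ⊗ₜ elG r) := by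
  have hr := r.ne_zero
  have hFF : elF r * elF r * elc r = (r : ℂ) • (Ap r ^ 2 * P r) := by
    simp only [elF, elc, pow_two, mul_assoc, K_Kinv, P_P, P_K, P_Kinv, P_Ap, K_Ap, Kinv_Ap,
      push (K_Kinv r), push (K_Ap r), smul_mul_assoc, mul_smul_comm, mul_one, one_mul]
  rw [(isCoaction_tau h).map_F, hFF, elF_mul_elc, ← qDiff_eq]
  simp only [map_add, map_smul, inclAlg, Algebra.TensorProduct.map_tmul, AlgHom.id_apply,
    Subalgebra.coe_val, genE, genF, genC, genG, elE, elF, elC, elG, elc,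
    TensorProduct.tmul_smul, ← TensorProduct.smul_tmul', smul_smul]
  match_scalars <;> field_simp

theorem tau_genC (h : (r : ℂ) ^ 4 ≠ 1) : inclAlg r (tau r (genC r)) =
    1 ⊗ₜ elC r + (-1 : ℂ) • (elF r ⊗ₜ elE r) := by
  rw [(isCoaction_tau h).map_C, ← qDiff_eq, neg_one_smul, ← sub_eq_add_neg]
  simp only [map_sub, map_smul, inclAlg, Algebra.TensorProduct.map_tmul, AlgHom.id_apply, elE,
    TensorProduct.tmul_smul]
  rfl

theorem tau_genE (h : (r : ℂ) ^ 4 ≠ 1) : inclAlg r (tau r (qDiff r • genE r)) =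
    elC r ⊗ₜ elE r := by
  rw [map_smul, (isCoaction_tau h).map_E]
  simp only [map_smul, inclAlg, Algebra.TensorProduct.map_tmul, AlgHom.id_apply, elE,
    TensorProduct.tmul_smul]
  rfl

theorem tau_genG (h : (r : ℂ) ^ 4 ≠ 1) : inclAlg r (tau r (qDiff r • genG r)) =
    1 ⊗ₜ elG r := by
  rw [map_smul, (isCoaction_tau h).map_G]
  simp only [map_smul, inclAlg, Algebra.TensorProduct.map_tmul, AlgHom.id_apply, elG,
    TensorProduct.tmul_smul]
  rfl

end Values

/-! ### Reduction to three slots -/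

section ThreeSlots
variable {r : ℂˣ}

theorem isTriHom_of_commute {A R : Type*} [Ring A] [Algebra ℂ A] [Ring R] [Algebra ℂ R]
    (u v w : A →ₐ[ℂ] R) (huv : ∀ a b, Commute (u a) (v b)) (huw : ∀ a b, Commute (u a) (w b))
    (hvw : ∀ a b, Commute (v a) (w b)) : IsTriHom fun a b c => u a * (v b * w c) where
  one := by simp
  mul a b c a' b' c' := by
    rw [((huv a' b).symm.mul_left (huw a' c).symm).mul_mul_mul_comm,
      (hvw b' c).symm.mul_mul_mul_comm, map_mul, map_mul, map_mul]
  add_left _ _ _ _ := by simp only [map_add, add_mul]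
  add_mid _ _ _ _ := by simp only [map_add, add_mul, mul_add]
  add_right _ _ _ _ := by simp only [map_add, mul_add]
  smul_left _ _ _ _ := by simp only [map_smul, smul_mul_assoc]
  smul_mid _ _ _ _ := by simp only [map_smul, smul_mul_assoc, mul_smul_comm]
  smul_right _ _ _ _ := by simp only [map_smul, mul_smul_comm]

theorem lastSlot_onSlot {n : ℕ} {i j : Fin n} (hij : i ≠ j)
    (φ : coidealAlg r →ₐ[ℂ] Osp r ⊗[ℂ] coidealAlg r) (t : Tens r n) (y : coidealAlg r) :
    lastSlot r j (onSlot r φ i (t ⊗ₜ y)) =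
      t * Algebra.TensorProduct.lift (slot r i) (slot r j) (slot_commute r hij)
        (inclAlg r (φ y)) := by
  rw [onSlot_tmul]
  induction φ y with
  | zero => simp only [map_zero, mul_zero]
  | add a b ha hb => simp only [map_add, mul_add, ha, hb]
  | tmul a y =>
    simp only [inclAlg, Algebra.TensorProduct.map_tmul, Algebra.TensorProduct.tmul_mul_tmul,
      AlgHom.id_apply, one_mul, lastSlot_tmul, Algebra.TensorProduct.lift_tmul, mul_assoc,
      Subalgebra.coe_val]

/-- With m = k + 2, the map is f(a,b,c) = D(a) · b in slot m · c in slot m + 1, the slots being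
numbered from 1 here. Each operator is a coproduct or coaction of the Casimir element, and its
expansion is the matching `cas` expression. -/
theorem exists_isTriHom (h : (r : ℂ) ^ 4 ≠ 1) {n k : ℕ} (hk : k + 3 ≤ n) :
    ∃ f : Osp r → Osp r → Osp r → Tens r n, IsTriHom f ∧
      qDiff r • Gam r n {k + 2, k + 3} = cas23 r (elE r) (elF r) (elC r) (elG r) (elc r) f ∧
      qDiff r • Gam r n (Finset.Icc 1 (k + 1) ∪ {k + 3}) =
        cas13 r (elE r) (elF r) (elC r) (elG r) (elc r) f ∧
      qDiff r • Gam r n (Finset.Icc 1 (k + 2)) =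
        cas12 r (elE r) (elF r) (elC r) (elG r) (elc r) f ∧
      qDiff r • Gam r n (Finset.Icc 1 (k + 3)) =
        cas123 r (elE r) (elF r) (elC r) (elG r) (elc r) f ∧
      qDiff r • Gam r n (Finset.Icc 1 (k + 1)) = f (elG r) 1 1 ∧
      qDiff r • Gam r n {k + 2} = f 1 (elG r) 1 ∧
      qDiff r • Gam r n {k + 3} = f 1 1 (elG r) := by
  obtain ⟨D, hD, hstage, hval⟩ := exists_iterated_comul r (n := n) k (by lia)
  have h2 : k + 2 ≤ n := Nat.le_of_succ_le hk
  have hne : (⟨k + 1, h2⟩ : Fin n) ≠ ⟨k + 2, hk⟩ := by simp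
  refine ⟨fun a b c => D a * (slot r ⟨k + 1, h2⟩ b * slot r ⟨k + 2, hk⟩ c),
    isTriHom_of_commute D _ _ (hD ⟨k + 1, h2⟩ le_rfl) (hD ⟨k + 2, hk⟩ (Nat.le_succ _))
      (slot_commute r hne), ?_, ?_, ?_, ?_, ?_, ?_, ?_⟩
  · rw [Gam_pair r hk, lastSlot_onSlot hne, inclAlg_comulI, one_mul, ← map_smul, ← map_smul]
    change Algebra.TensorProduct.lift _ _ _ (comul r (elG r)) = _
    rw [comul_elG h]
    simp only [map_add, map_smul, Algebra.TensorProduct.lift_tmul, cas23, map_one, one_mul]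
  · rw [Gam_skip r hk, hstage, ← map_smul, ← map_smul, ← map_smul, smul_comulI_genG h]
    simp only [map_add, map_smul (lastSlot r _), map_smul (onSlot r _ _),
      map_smul (Algebra.TensorProduct.map D _), Algebra.TensorProduct.map_tmul, AlgHom.id_apply,
      lastSlot_onSlot hne, tau_genF h, tau_genC h, tau_genE h, tau_genG h,
      map_smul (Algebra.TensorProduct.lift _ _ _), Algebra.TensorProduct.lift_tmul, cas13, mul_add,
      mul_smul_comm, map_one, smul_add]
  · rw [Gam_Icc r h2, hstage, ← map_smul, ← map_smul, smul_comulI_genG h]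
    simp only [map_add, map_smul (lastSlot r _),
      map_smul (Algebra.TensorProduct.map D _), Algebra.TensorProduct.map_tmul, AlgHom.id_apply,
      lastSlot_tmul, cas12, map_one, mul_one]
    rfl
  · rw [Gam_Icc r hk, comulIter, padStage_onLast, hstage, ← map_smul, ← map_smul, ← map_smul,
      smul_comulI_genG h]
    have eE : comul r (qDiff r • genE r : coidealAlg r) = _ := comul_elE
    have eF : comul r (genF r : coidealAlg r) = _ := comul_elF
    have eC : comul r (genC r : coidealAlg r) = _ := comul_elC
    have eG : comul r (qDiff r • genG r : coidealAlg r) = _ := comul_elG h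
    simp only [map_add, map_smul (lastSlot r _), map_smul (onSlot r _ _),
      map_smul (Algebra.TensorProduct.map D _), Algebra.TensorProduct.map_tmul, AlgHom.id_apply,
      lastSlot_onSlot hne, inclAlg_comulI, eE, eF, eC, eG,
      map_smul (Algebra.TensorProduct.lift _ _ _), Algebra.TensorProduct.lift_tmul, cas123, mul_add,
      mul_smul_comm, map_one, smul_add]
  · rw [Gam_Icc r (Nat.le_of_succ_le h2), hval, ← map_smul]
    beta_reduce
    rw [map_one, map_one, mul_one, mul_one]
    rfl
  · rw [Gam_singleton r h2, ← map_smul]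
    beta_reduce
    rw [map_one, map_one, mul_one, one_mul]
    rfl
  · rw [Gam_singleton r hk, ← map_smul]
    beta_reduce
    rw [map_one, map_one, one_mul, one_mul]
    rfl

end ThreeSlots

/-! ### Removing the scaling, and the consequences of the q-anticommutators -/

section Unscaled

theorem mem_of_qAnticommutator {A : Type*} [Ring A] [Algebra ℂ A] {S : Subalgebra ℂ A} {r d : ℂ}
    (hr : r + r⁻¹ ≠ 0) {X Y Z W : A} (hX : X ∈ S) (hY : Y ∈ S) (hZ : Z ∈ S)
    (h : r • (X * Y) + r⁻¹ • (Y * X) = d • Z + (r + r⁻¹) • W) : W ∈ S := by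
  have hW : W = (r + r⁻¹)⁻¹ • (r • (X * Y) + r⁻¹ • (Y * X) - d • Z) := by
    rw [h, add_sub_cancel_left, smul_smul, inv_mul_cancel₀ hr, one_smul]
  rw [hW]
  exact S.smul_mem (S.sub_mem (S.add_mem (S.smul_mem (S.mul_mem hX hY) _)
    (S.smul_mem (S.mul_mem hY hX) _)) (S.smul_mem hZ _)) _

/-- The relation can be solved for `Z`. This avoids a direct computation with the twisted element
`cas13`, by far the longest of the pair operators. -/
theorem commute_of_qAnticommutator {A : Type*} [Ring A] [Algebra ℂ A] {r d : ℂ}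
    (hd : d ≠ 0) {X Y Z W S : A} (hX : Commute S X) (hY : Commute S Y) (hW : Commute S W)
    (h : r • (X * Y) + r⁻¹ • (Y * X) = d • Z + (r + r⁻¹) • W) : Commute S Z := by
  have hZ : Z = d⁻¹ • (r • (X * Y) + r⁻¹ • (Y * X) - (r + r⁻¹) • W) := by
    rw [h, add_sub_cancel_right, smul_smul, inv_mul_cancel₀ hd, one_smul]
  rw [hZ]
  exact ((((hX.mul_right hY).smul_right _).add_right ((hY.mul_right hX).smul_right _)).sub_right
    (hW.smul_right _)).smul_right _

/-- The relation is divided by d². As d = q - q⁻¹ is both the scaling factor and the coefficient of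
the linear term, that coefficient becomes 1. -/
theorem smul_qAnticommutator {A : Type*} [Ring A] [Algebra ℂ A] {r d : ℂ}
    (hd : d ≠ 0) {X Y Z L M N T : A}
    (h : r • ((d • X) * (d • Y)) + r⁻¹ • ((d • Y) * (d • X)) =
      d • (d • Z) + (r + r⁻¹) • ((d • M) * (d • L) + (d • N) * (d • T))) :
    r • (X * Y) + r⁻¹ • (Y * X) = (1 : ℂ) • Z + (r + r⁻¹) • (M * L + N * T) := by
  have h' := congrArg ((d * d)⁻¹ • ·) h
  simp only [smul_mul_smul_comm] at h'
  refine Eq.trans ?_ (h'.trans ?_) <;> match_scalars <;> field_simp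

end Unscaled

/-- The elements attached to the seven sets generate a copy of the `q`-Bannai-Ito algebra. -/
theorem Gam_relations {r : ℂˣ} (h : (r : ℂ) ^ 4 ≠ 1) {n k : ℕ} (hk : k + 3 ≤ n)
    {X Y Z L M N T : Tens r n} (hX : X = Gam r n {k + 2, k + 3})
    (hY : Y = Gam r n (Finset.Icc 1 (k + 1) ∪ {k + 3})) (hZ : Z = Gam r n (Finset.Icc 1 (k + 2)))
    (hT : T = Gam r n (Finset.Icc 1 (k + 3))) (hL : L = Gam r n (Finset.Icc 1 (k + 1)))
    (hM : M = Gam r n {k + 2}) (hN : N = Gam r n {k + 3}) :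
    ((r : ℂ) • (X * Y) + (r : ℂ)⁻¹ • (Y * X) = (1 : ℂ) • Z + ((r : ℂ) + (r : ℂ)⁻¹) • (M * L + N * T) ∧
      (r : ℂ) • (Y * Z) + (r : ℂ)⁻¹ • (Z * Y) =
        (1 : ℂ) • X + ((r : ℂ) + (r : ℂ)⁻¹) • (M * N + L * T) ∧
      (r : ℂ) • (Z * X) + (r : ℂ)⁻¹ • (X * Z) =
        (1 : ℂ) • Y + ((r : ℂ) + (r : ℂ)⁻¹) • (N * L + M * T)) ∧
    (∀ S ∈ ({L, M, N, T} : Set (Tens r n)), Commute S X ∧ Commute S Y ∧ Commute S Z) ∧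
    casimirC r n (k + 2) =
      L ^ 2 + M ^ 2 + N ^ 2 + T ^ 2 - ((r : ℂ) ^ 2 - ((r : ℂ) ^ 2)⁻¹) ^ 2 • (M * N * L * T)
        - algebraMap ℂ (Tens r n) ((r : ℂ) ^ 2 / (1 + (r : ℂ) ^ 2) ^ 2) := by
  have hr := r.ne_zero
  have hd := qDiff_ne_zero h
  have hs : 1 + (r : ℂ) ^ 2 ≠ 0 := fun h0 => h (by linear_combination ((r : ℂ) ^ 2 - 1) * h0)
  obtain ⟨f, hf, fX, fY, fZ, fT, fL, fM, fN⟩ := exists_isTriHom h hk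
  rw [← hX] at fX
  rw [← hY] at fY
  rw [← hZ] at fZ
  rw [← hT] at fT
  rw [← hL] at fL
  rw [← hM] at fM
  rw [← hN] at fN
  obtain ⟨q1, q2, q3⟩ := qAnticommutators hr (gwInv_el h) hf fX fY fZ fT fL fM fN
  have q1' := smul_qAnticommutator hd q1
  have q2' := smul_qAnticommutator hd q2
  have q3' := smul_qAnticommutator hd q3
  have cancel : ∀ {S S' : Tens r n}, Commute (qDiff r • S) (qDiff r • S') → Commute S S' :=
    fun {S S'} hc => (Commute.smul_left_iff₀ hd).1 ((Commute.smul_right_iff₀ hd).1 hc)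
  have hcomm : ∀ S ∈ ({L, M, N, T} : Set (Tens r n)),
      Commute S X ∧ Commute S Z ∧ Commute S L ∧ Commute S M ∧ Commute S N := by
    intro S hS
    have := commute_cas hr (gwInv_el h) hf fX fZ (S := qDiff r • S) (by
      rw [← fL, ← fM, ← fN, ← fT]
      rcases hS with rfl | rfl | rfl | rfl <;> simp)
    rw [← fL, ← fM, ← fN] at this
    exact ⟨cancel this.1, cancel this.2.1, cancel this.2.2.1, cancel this.2.2.2.1,
      cancel this.2.2.2.2⟩
  refine ⟨⟨q1', q2', q3'⟩, fun S hS => ?_, ?_⟩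
  · obtain ⟨cX, cZ, cL, cM, cN⟩ := hcomm S hS
    have cT : Commute S T := by
      obtain ⟨-, -, tL, tM, tN⟩ := hcomm T (by simp)
      rcases hS with rfl | rfl | rfl | rfl
      exacts [tL.symm, tM.symm, tN.symm, Commute.refl _]
    exact ⟨cX, commute_of_qAnticommutator one_ne_zero cZ cX
      ((cN.mul_right cL).add_right (cM.mul_right cT)) q3', cZ⟩
  · have hid := casimir_identity hr (gwInv_el h) hf fX fY fZ fT fL fM fN
    have hC : casimirC r n (k + 2) = ((r : ℂ)⁻¹ - (r : ℂ) ^ 3) • (X * Y * Z)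
        + qq r • X ^ 2 + (qq r)⁻¹ • Y ^ 2 + qq r • Z ^ 2
        - ((r : ℂ)⁻¹ - (r : ℂ) ^ 3) • ((M * N + L * T) * X)
        - ((r : ℂ)⁻¹ - (r : ℂ) ^ 3) • ((M * L + N * T) * Z)
        - ((r : ℂ) - ((r : ℂ) ^ 3)⁻¹) • ((N * L + M * T) * Y) := by
      rw [hX, hY, hZ, hT, hL, hM, hN]; rfl
    rw [hC]
    -- Multiplying by (q - q⁻¹)² makes the claim `casimir_identity`: r⁻¹ - r³ = -r(q - q⁻¹) accounts
    -- for the cubic terms, and q/(1+q)² becomes (r - r⁻¹)².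
    refine smul_right_injective _ (mul_ne_zero hd hd) (sub_eq_zero.1 ?_)
    refine Eq.trans ?_ (sub_eq_zero.2 hid)
    simp only [smul_mul_smul_comm, smul_mul_assoc, mul_smul_comm, smul_smul, pow_two X, pow_two Y,
      pow_two Z, pow_two L, pow_two M, pow_two N, pow_two T, add_mul, mul_assoc,
      Algebra.algebraMap_eq_smul_one, qq, qDiff]
    match_scalars <;> field_simp <;> ring

end QBI

end

theorem lemma2p7 (q : ℂ) (hq0 : q ≠ 0) (hq1 : ‖q‖ ≠ 1) (r : ℂˣ) (hr : (r : ℂ) ^ 2 = q)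
    (n m : ℕ) (hm : 2 ≤ m) (hmn : m ≤ n - 1) :
    (QBI.casimirC r n m ∈ QBI.rankOneAlg r n m ∧
      ∀ x ∈ QBI.rankOneAlg r n m, Commute (QBI.casimirC r n m) x) ∧
    QBI.casimirC r n m =
      QBI.Gam r n (Finset.Icc 1 (m - 1)) ^ 2 + QBI.Gam r n {m} ^ 2
        + QBI.Gam r n {m + 1} ^ 2 + QBI.Gam r n (Finset.Icc 1 (m + 1)) ^ 2
        - (q - q⁻¹) ^ 2 • (QBI.Gam r n {m} * QBI.Gam r n {m + 1}
          * QBI.Gam r n (Finset.Icc 1 (m - 1)) * QBI.Gam r n (Finset.Icc 1 (m + 1)))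
        - algebraMap ℂ (QBI.Tens r n) (q / (1 + q) ^ 2) := by
  subst hr
  have h4 : (r : ℂ) ^ 4 ≠ 1 := fun h => hq1 <| by
    have : ‖(r : ℂ) ^ 2‖ ^ 2 = 1 := by rw [← norm_pow, ← pow_mul, h, norm_one]
    exact (pow_eq_one_iff_of_nonneg (norm_nonneg _) two_ne_zero).1 this
  have hs : (r : ℂ) + (r : ℂ)⁻¹ ≠ 0 := fun h => h4 <| by
    have hr := r.ne_zero
    field_simp at h
    linear_combination ((r : ℂ) ^ 2 - 1) * h
  obtain ⟨k, rfl⟩ := Nat.exists_eq_add_of_le' hm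
  obtain ⟨⟨h1, h2, h3⟩, hcomm, hval⟩ := QBI.Gam_relations h4 (n := n) (k := k) (by lia)
    rfl rfl rfl rfl rfl rfl rfl
  refine ⟨⟨?_, ?_⟩, hval⟩
  · have hZ : QBI.Gam r n (Finset.Icc 1 (k + 2)) ∈ QBI.rankOneAlg r n (k + 2) :=
      Algebra.subset_adjoin (by simp)
    have hX : QBI.Gam r n {k + 2, k + 3} ∈ QBI.rankOneAlg r n (k + 2) :=
      Algebra.subset_adjoin (by simp)
    have hY : QBI.Gam r n (Finset.Icc 1 (k + 1) ∪ {k + 3}) ∈ QBI.rankOneAlg r n (k + 2) :=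
      Algebra.subset_adjoin (by simp)
    -- Only the sums ML + NT, MN + LT and NL + MT occur in C_m, so no membership is needed for L, M,
    -- N, T themselves.
    have w1 := QBI.mem_of_qAnticommutator hs hX hY hZ h1
    have w2 := QBI.mem_of_qAnticommutator hs hY hZ hX h2
    have w3 := QBI.mem_of_qAnticommutator hs hZ hX hY h3
    exact sub_mem (sub_mem (sub_mem (add_mem (add_mem (add_mem
      (Subalgebra.smul_mem _ (mul_mem (mul_mem hX hY) hZ) _)
      (Subalgebra.smul_mem _ (pow_mem hX 2) _)) (Subalgebra.smul_mem _ (pow_mem hY 2) _))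
      (Subalgebra.smul_mem _ (pow_mem hZ 2) _)) (Subalgebra.smul_mem _ (mul_mem w2 hX) _))
      (Subalgebra.smul_mem _ (mul_mem w1 hZ) _)) (Subalgebra.smul_mem _ (mul_mem w3 hY) _)
  · intro x hx
    -- Centrality is read off the closed formula, whose ingredients all commute with the generators.
    rw [hval]
    have hgen : ∀ y ∈ ({QBI.Gam r n (Finset.Icc 1 (k + 2)), QBI.Gam r n {k + 2, k + 3},
        QBI.Gam r n (Finset.Icc 1 (k + 1) ∪ {k + 3})} : Set (QBI.Tens r n)),
        ∀ S ∈ ({QBI.Gam r n (Finset.Icc 1 (k + 1)), QBI.Gam r n {k + 2}, QBI.Gam r n {k + 3},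
          QBI.Gam r n (Finset.Icc 1 (k + 3))} : Set (QBI.Tens r n)), Commute S y := by
      rintro y (rfl | rfl | rfl) S hS
      exacts [(hcomm S hS).2.2, (hcomm S hS).1, (hcomm S hS).2.1]
    have hc : ∀ S ∈ ({QBI.Gam r n (Finset.Icc 1 (k + 1)), QBI.Gam r n {k + 2}, QBI.Gam r n {k + 3},
          QBI.Gam r n (Finset.Icc 1 (k + 3))} : Set (QBI.Tens r n)), Commute S x := fun S hS => by
      refine Algebra.commute_of_mem_adjoin_of_forall_mem_commute hx fun y hy => hgen y hy S hS
    have cL := hc (QBI.Gam r n (Finset.Icc 1 (k + 1))) (by simp)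
    have cM := hc (QBI.Gam r n {k + 2}) (by simp)
    have cN := hc (QBI.Gam r n {k + 3}) (by simp)
    have cT := hc (QBI.Gam r n (Finset.Icc 1 (k + 3))) (by simp)
    exact ((((((cL.pow_left 2).add_left (cM.pow_left 2)).add_left (cN.pow_left 2)).add_left
      (cT.pow_left 2)).sub_left ((((cM.mul_left cN).mul_left cL).mul_left cT).smul_left _)).sub_left
      (Algebra.commute_algebraMap_left _ _))
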